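/- Let $n\ge 1$ and let $p_i:(0,1]\to[0,\infty)$, $i=1,\dots,n$, be $C^1$, strictly decreasing, convex, integrable functions with $\lim_{x\to0^+}p_i(x)=+\infty$ (for example $p_i(x)=s_ix^{-\gamma}$ with $s_i>0$, $\gamma\in(0,1)$). Write $\mathrm{int}(\Delta_n)=\{x\in\mathbb R^n: x>0,\ \mathbf 1^\top x=1\}$ and $p(w)=(p_1(w_1),\dots,p_n(w_n))^\top$, and assume that $p(w)>0$ for $w\in\mathrm{int}(\Delta_n)$ (automatic if $n\ge2$). There is a unique pair $(p^*,w^{\mathrm{opt}})$ with $p^*>0$, $w^{\mathrm{opt}}\in\mathrm{int}(\Delta_n)$ and $p(w^{\mathrm{opt}})=p^*\mathbf 1$. The ASAP model with donor-controlled work flow is the system $$\dot a_{ij}=a_{ij}\Big(p_j(w_j)-\sum_{k=1}^n a_{ik}p_k(w_k)\Big),\qquad \dot w_i=-w_i+\sum_{k=1}^n a_{ki}w_k ,$$ whose solutions are understood to satisfy $w_i(t)\in(0,1]$, the domain of $p_i$. For an irreducible row-stochastic matrix $B$ let $v_{\mathrm{left}}(B)$ denote its left dominant eigenvector: the entrywise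 positive left eigenvector of unit sum for the dominant eigenvalue of $B$. Let $A_0\in\mathbb R^{n\times n}$ be row-stochastic and irreducible with strictly positive diagonal, and let $w_0\in\mathrm{int}(\Delta_n)$. Then the model has a solution on $[0,\infty)$ with $(A(0),w(0))=(A_0,w_0)$, and every such solution $(A(t),w(t))$ has the following properties. (i) If $n=2$ and $A_0>0$ entrywise, then $\lim_{t\to\infty}(A(t),w(t))=(A^*,w^{\mathrm{opt}})$ for some row-stochastic $A^*>0$ with $w^{\mathrm{opt}}=v_{\mathrm{left}}(A^*)$. (ii) If $A_0=\mathbf 1a^\top$ for some $a\in\mathrm{int}(\Delta_n)$ (so that $a$ is the diagonal of $A_0$), then $\lim_{t\to\infty}(A(t),w(t))=(\mathbf 1(w^{\mathrm{opt}})^\top,w^{\mathrm{opt}})$. (iii) For $v\in\mathbb R^n_{>0}$ put $\mathcal A(v)=\mathrm{diag}(A_0v)^{-1}A_0\,\mathrm{diag}(v)$. The reduced-order system $$\dot v=\mathrm{diag}\big(p(\bar w)-\bar w^\top\mathcal A(v)p(\bar w)\mathbf 1\big)v,\qquad \dot{\bar w}=-\bar w+\mathcal A(v)^\top\bar w,$$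 has a solution on $[0,\infty)$ with values in $\mathbb R^n_{>0}\times\mathrm{int}(\Delta_n)$ and $(v(0),\bar w(0))=(\mathbf 1,w_0)$. If for such a solution $v(t)$ is bounded on $[0,\infty)$, then $\lim_{t\to\infty}(A(t),w(t))=(A^*,w^{\mathrm{opt}})$ for some row-stochastic $A^*$ that has the same zero/positive pattern as $A_0$ and satisfies $w^{\mathrm{opt}}=v_{\mathrm{left}}(A^*)$. -/

import Mathlib

open Filter Topology

/-- The relative interior of the simplex: entrywise positive vectors with unit sum. -/
def intSimplex (n : ℕ) : Set (Fin n → ℝ) :=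
  {x | (∀ i, 0 < x i) ∧ ∑ i, x i = 1}

/-- An individual performance function `(0,1] → [0,∞)`: `C¹`, strictly decreasing, convex,
integrable, and tending to `+∞` at `0⁺`. Values outside `(0,1]` are irrelevant. -/
structure IsPerformanceFunction (f : ℝ → ℝ) : Prop where
  nonneg : ∀ x ∈ Set.Ioc (0 : ℝ) 1, 0 ≤ f x
  contDiffOn : ContDiffOn ℝ 1 f (Set.Ioc 0 1)
  strictAntiOn : StrictAntiOn f (Set.Ioc 0 1)
  convexOn : ConvexOn ℝ (Set.Ioc 0 1) f
  integrableOn : MeasureTheory.IntegrableOn f (Set.Ioc 0 1)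
  tendsto_zero : Tendsto f (𝓝[>] 0) atTop

/-- A family of performance functions for a team of `n` individuals; the vector of performances
`p(w)` is entrywise positive for workloads `w` in the relative interior of the simplex. -/
structure IsPerformanceFamily {n : ℕ} (p : Fin n → ℝ → ℝ) : Prop where
  each : ∀ i, IsPerformanceFunction (p i)
  pos : ∀ w ∈ intSimplex n, ∀ i, 0 < p i (w i)

/-- The vector of individual performances `p(w) = (p₁(w₁), …, pₙ(wₙ))`. -/
def perf {n : ℕ} (p : Fin n → ℝ → ℝ) (w : Fin n → ℝ) : Fin n → ℝ :=
  fun i => p i (w i)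

/-- The pair `(p*, w)` has `p* > 0`, `w` in the relative interior of the simplex, and
`p(w) = p* 𝟏`. -/
def IsOptimalPair {n : ℕ} (p : Fin n → ℝ → ℝ) (q : ℝ × (Fin n → ℝ)) : Prop :=
  0 < q.1 ∧ q.2 ∈ intSimplex n ∧ perf p q.2 = fun _ => q.1

/-- Right-hand side of the appraisal dynamics. -/
def appraisalField {n : ℕ} (p : Fin n → ℝ → ℝ) (A : Matrix (Fin n) (Fin n) ℝ)
    (w : Fin n → ℝ) : Matrix (Fin n) (Fin n) ℝ :=
  fun i j => A i j * (p j (w j) - ∑ k, A i k * p k (w k))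

/-- The donor-controlled work flow. -/
def donorFlow {n : ℕ} (A : Matrix (Fin n) (Fin n) ℝ) (w : Fin n → ℝ) : Fin n → ℝ :=
  fun i => -w i + ∑ k, A k i * w k

/-- `(A, w)` is a solution on `[0, ∞)` of the assignment and appraisal dynamics with
donor-controlled work flow and initial condition `(A₀, w₀)`. The condition `mem_domain` says that
the solution stays where the vector field is defined, each `p i` being a function on `(0,1]`. -/
structure IsASAPTrajectory {n : ℕ} (p : Fin n → ℝ → ℝ)
    (A₀ : Matrix (Fin n) (Fin n) ℝ) (w₀ : Fin n → ℝ)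
    (A : ℝ → Matrix (Fin n) (Fin n) ℝ) (w : ℝ → Fin n → ℝ) : Prop where
  init_A : A 0 = A₀
  init_w : w 0 = w₀
  mem_domain : ∀ t, 0 ≤ t → ∀ i, w t i ∈ Set.Ioc (0 : ℝ) 1
  deriv_A : ∀ t, 0 ≤ t → ∀ i j,
    HasDerivWithinAt (fun s => A s i j) (appraisalField p (A t) (w t) i j) (Set.Ici 0) t
  deriv_w : ∀ t, 0 ≤ t → ∀ i,
    HasDerivWithinAt (fun s => w s i) (donorFlow (A t) (w t) i) (Set.Ici 0) t

/-- The map `𝒜(v) = diag(A₀ v)⁻¹ A₀ diag(v)`. -/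
noncomputable def reducedAppraisal {n : ℕ} (A₀ : Matrix (Fin n) (Fin n) ℝ) (v : Fin n → ℝ) :
    Matrix (Fin n) (Fin n) ℝ :=
  Matrix.diagonal (fun i => ((A₀.mulVec v) i)⁻¹) * A₀ * Matrix.diagonal v

/-- `(v, w)` is a solution on `[0, ∞)`, with values in the positive vectors times the relative
interior of the simplex, of the reduced-order dynamics
`v' = diag(p(w) - wᵀ 𝒜(v) p(w) 𝟏) v`, `w' = -w + 𝒜(v)ᵀ w`,
with initial condition `(𝟏, w₀)`. -/
structure IsReducedTrajectory {n : ℕ} (p : Fin n → ℝ → ℝ)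
    (A₀ : Matrix (Fin n) (Fin n) ℝ) (w₀ : Fin n → ℝ)
    (v : ℝ → Fin n → ℝ) (w : ℝ → Fin n → ℝ) : Prop where
  init_v : v 0 = fun _ => 1
  init_w : w 0 = w₀
  pos_v : ∀ t, 0 ≤ t → ∀ i, 0 < v t i
  mem_w : ∀ t, 0 ≤ t → w t ∈ intSimplex n
  deriv_v : ∀ t, 0 ≤ t → ∀ i,
    HasDerivWithinAt (fun s => v s i)
      ((perf p (w t) i - w t ⬝ᵥ (reducedAppraisal A₀ (v t)).mulVec (perf p (w t))) * v t i)
      (Set.Ici 0) t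
  deriv_w : ∀ t, 0 ≤ t → ∀ i,
    HasDerivWithinAt (fun s => w s i) (donorFlow (reducedAppraisal A₀ (v t)) (w t) i)
      (Set.Ici 0) t

/-- `ρ` is the dominant eigenvalue of `B`: an eigenvalue whose modulus is maximal among all
complex eigenvalues of `B`. -/
def IsDominantEigenvalue {n : ℕ} (B : Matrix (Fin n) (Fin n) ℝ) (ρ : ℝ) : Prop :=
  (ρ : ℂ) ∈ spectrum ℂ (B.map Complex.ofReal) ∧
    ∀ μ ∈ spectrum ℂ (B.map Complex.ofReal), ‖μ‖ ≤ ρ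

/-- `B` is irreducible and row-stochastic, and `x` is its left dominant eigenvector: positive, of
unit sum, and a left eigenvector for the dominant eigenvalue. -/
def IsLeftDominantEigenvector {n : ℕ} (B : Matrix (Fin n) (Fin n) ℝ) (x : Fin n → ℝ) : Prop :=
  B.IsIrreducible ∧ B ∈ Matrix.rowStochastic ℝ (Fin n) ∧ x ∈ intSimplex n ∧
    ∃ ρ : ℝ, IsDominantEigenvalue B ρ ∧ Matrix.vecMul x B = ρ • x

/-- Two nonnegative matrices have the same zero/positive pattern. -/
def SamePattern {n : ℕ} (A B : Matrix (Fin n) (Fin n) ℝ) : Prop :=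
  ∀ i j, (A i j = 0 ↔ B i j = 0) ∧ (0 < A i j ↔ 0 < B i j)

/-! ### Calculus on the half-line -/

/-! Each row of `A` obeys a replicator equation, whose solution is explicit in the cumulative
performances `y`, given by `y' = p(w)`, `y(0) = 0`: the matrix `A` is `A₀ diag(exp y)` with rows
normalised (`softAppraisal`). Both the full and the reduced dynamics are thus encoded by the system
for `(y, w)`, with `v = exp(y - Θ)` and `Θ' = wᵀ A p(w)`. That system has exactly one global
solution: `w i` decays at rate at most one, so the singularity of `p` at zero is not reached in
finite time.

With `z' = ∑ p i (w i) * w i` and `z(0) = 0`, the potential `U = ∑ wopt i * y i - z` has derivative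
`∑ (wopt i - w i) * (p i (w i) - p i (wopt i))`, nonnegative because each `p i` decreases. If `y i -
z` is bounded above, then `U` converges and a Barbalat argument gives `w → wopt`
(`IsCumulativeTrajectory.tendsto_w`); a second one gives `w' → 0`. Since `U ≥ 0`, the vector `y - z`
is also bounded below, and every limit point of `A` leaves `wopt` invariant. A scaling-uniqueness
argument leaves only one such point (`softAppraisal_eq_of_donorFlow`), so `A` converges
(`IsCumulativeTrajectory.tendsto_of_bounded`).

It remains to bound `y i - z` above. Integrability of `p` makes `Θ - z` bounded, so a bound on `v`
suffices. For rank-one `A₀`, `Θ` is the logarithm of `∑ a k * exp (y k)`, which dominates each `y i`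
up to a constant. For `n = 2`, an energy `E` satisfies `E' = -(A 0 1 + A 1 0) * U'`; it first
controls the spread of `y`, hence keeps `A 0 1` away from zero, and then bounds `U`. -/

theorem monotoneOn_Ici_of_hasDerivWithinAt {f f' : ℝ → ℝ} {a : ℝ}
    (h : ∀ t, a ≤ t → HasDerivWithinAt f (f' t) (Set.Ici a) t) (h0 : ∀ t, a ≤ t → 0 ≤ f' t) :
    MonotoneOn f (Set.Ici a) := by
  refine monotoneOn_of_hasDerivWithinAt_nonneg (convex_Ici a)
    (fun t ht => (h t ht).continuousWithinAt) (f' := f') (fun t ht => ?_) (fun t ht => ?_)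
  · exact (h t (interior_subset ht)).mono interior_subset
  · exact h0 t (interior_subset ht)

theorem antitoneOn_Ici_of_hasDerivWithinAt {f f' : ℝ → ℝ} {a : ℝ}
    (h : ∀ t, a ≤ t → HasDerivWithinAt f (f' t) (Set.Ici a) t) (h0 : ∀ t, a ≤ t → f' t ≤ 0) :
    AntitoneOn f (Set.Ici a) := by
  have := monotoneOn_Ici_of_hasDerivWithinAt (fun t ht => (h t ht).neg)
    (fun t ht => neg_nonneg.2 (h0 t ht))
  intro x hx y hy hxy
  simpa using this hx hy hxy

theorem eq_of_hasDerivWithinAt_zero_Ici {f : ℝ → ℝ}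
    (h : ∀ t, 0 ≤ t → HasDerivWithinAt f 0 (Set.Ici 0) t) {t : ℝ} (ht : 0 ≤ t) : f t = f 0 :=
  le_antisymm
    (antitoneOn_Ici_of_hasDerivWithinAt h (fun _ _ => le_rfl) Set.self_mem_Ici ht ht)
    (monotoneOn_Ici_of_hasDerivWithinAt h (fun _ _ => le_rfl) Set.self_mem_Ici ht ht)

/-- A function with derivative `x * r` is an exponential of an antiderivative of `r`. -/
theorem eq_mul_exp_of_hasDerivWithinAt {x r R : ℝ → ℝ}
    (hx : ∀ t, 0 ≤ t → HasDerivWithinAt x (x t * r t) (Set.Ici 0) t)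
    (hR : ∀ t, 0 ≤ t → HasDerivWithinAt R (r t) (Set.Ici 0) t) (hR0 : R 0 = 0)
    {t : ℝ} (ht : 0 ≤ t) : x t = x 0 * Real.exp (R t) := by
  have h : ∀ s, 0 ≤ s →
      HasDerivWithinAt (fun s => x s * Real.exp (-R s)) 0 (Set.Ici 0) s := fun s hs => by
    refine ((hx s hs).fun_mul (hR s hs).fun_neg.exp).congr_deriv ?_
    ring
  have := eq_of_hasDerivWithinAt_zero_Ici h ht
  simp only [hR0, neg_zero, Real.exp_zero, mul_one] at this
  rw [← this, mul_assoc, ← Real.exp_add]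
  simp

theorem exists_antiderivative_Ici {h : ℝ → ℝ} (hc : ContinuousOn h (Set.Ici 0)) :
    ∃ H : ℝ → ℝ, H 0 = 0 ∧ ∀ t, 0 ≤ t → HasDerivWithinAt H (h t) (Set.Ici 0) t := by
  -- Freezing `h` at its value at zero makes it continuous on the whole line, so the two-sided
  -- fundamental theorem applies even at the endpoint.
  have hc' : Continuous fun t => h (max t 0) :=
    hc.comp_continuous (by fun_prop) fun t => Set.mem_Ici.2 (le_max_right _ _)
  refine ⟨fun t => ∫ s in (0 : ℝ)..t, h (max s 0), by simp, fun t ht => ?_⟩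
  have := (hc'.integral_hasStrictDerivAt 0 t).hasDerivAt.hasDerivWithinAt (s := Set.Ici 0)
  rwa [max_eq_left ht] at this

theorem abs_sub_le_of_hasDerivWithinAt {f f' : ℝ → ℝ} {a K : ℝ}
    (h : ∀ t, a ≤ t → HasDerivWithinAt f (f' t) (Set.Ici a) t) (hK : ∀ t, a ≤ t → |f' t| ≤ K)
    {s t : ℝ} (hs : a ≤ s) (ht : a ≤ t) : |f t - f s| ≤ K * |t - s| :=
  (convex_Ici a).norm_image_sub_le_of_norm_hasDerivWithin_le (fun x hx => h x hx)
    (fun x hx => hK x hx) hs ht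

/-- A Barbalat-type lemma: if `U` converges and its derivative is bounded below by a positive
constant on each superlevel set of the Lipschitz function `f`, then `f` is eventually small. -/
theorem eventually_lt_of_hasDerivWithinAt {U U' f : ℝ → ℝ} {a K l : ℝ} (hK : 0 ≤ K)
    (hU : ∀ t, a ≤ t → HasDerivWithinAt U (U' t) (Set.Ici a) t)
    (hl : Tendsto U atTop (𝓝 l))
    (hf : ∀ s t, a ≤ s → a ≤ t → |f t - f s| ≤ K * |t - s|)
    (hm : ∀ δ > 0, ∃ m > 0, ∀ t, a ≤ t → δ ≤ f t → m ≤ U' t) {δ : ℝ} (hδ : 0 < δ) :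
    ∀ᶠ t in atTop, f t < δ := by
  obtain ⟨m, hm0, hm⟩ := hm (δ / 2) (half_pos hδ)
  have hK1 : 0 < K + 1 := by linarith
  -- If `f t ≥ δ`, the Lipschitz bound keeps `f ≥ δ / 2` for time `h`, so `U` grows by at least `m *
  -- h`, against its convergence. The `+ 1` covers `K = 0`.
  set h : ℝ := δ / 2 / (K + 1) with hh
  have hpos : 0 < h := by positivity
  have hlim : Tendsto (fun t => U (t + h) - U t) atTop (𝓝 0) := by
    simpa using (hl.comp (tendsto_atTop_add_const_right _ h tendsto_id)).sub hl
  have hev := hlim.eventually (gt_mem_nhds (mul_pos hm0 hpos))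
  filter_upwards [hev, eventually_ge_atTop a] with t ht hta
  by_contra hcon
  push Not at hcon
  have hlow : ∀ s ∈ Set.Icc t (t + h), m ≤ U' s := fun s hs => by
    refine hm s (hta.trans hs.1) ?_
    have h1 := hf t s hta (hta.trans hs.1)
    have h2 : K * |s - t| ≤ (K + 1) * h := by
      rw [abs_of_nonneg (by linarith [hs.1])]
      have : s - t ≤ h := by linarith [hs.2]
      exact mul_le_mul (by linarith) this (by linarith [hs.1]) hK1.le
    have h3 : (K + 1) * h = δ / 2 := by rw [hh]; field_simp
    have := (abs_le.1 h1).1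
    linarith
  have hmono : MonotoneOn (fun s => U s - m * s) (Set.Icc t (t + h)) := by
    have hd : ∀ s ∈ Set.Icc t (t + h),
        HasDerivWithinAt (fun s => U s - m * s) (U' s - m) (Set.Icc t (t + h)) s := fun s hs => by
      have := ((hU s (hta.trans hs.1)).mono
        (fun x hx => hta.trans hx.1 : Set.Icc t (t + h) ⊆ Set.Ici a)).sub
        ((hasDerivWithinAt_id s _).const_mul m)
      rw [mul_one] at this
      exact this
    refine monotoneOn_of_hasDerivWithinAt_nonneg (convex_Icc _ _)
      (fun s hs => (hd s hs).continuousWithinAt)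
      (fun s hs => (hd s (interior_subset hs)).mono interior_subset) (fun s hs => ?_)
    linarith [hlow s (interior_subset hs)]
  have := hmono (Set.left_mem_Icc.2 (by linarith)) (Set.right_mem_Icc.2 (by linarith))
    (by linarith)
  simp only at this
  nlinarith

/-! ### Global existence and uniqueness for bounded Lipschitz fields -/

section GlobalODE

variable {E : Type*} [NormedAddCommGroup E] [NormedSpace ℝ E]

theorem eqOn_of_hasDerivWithinAt_Icc {f : ℝ → E → E} {T : ℝ} {K : NNReal}
    (hK : ∀ t ∈ Set.Icc 0 T, LipschitzWith K (f t)) {x y : ℝ → E}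
    (hx : ∀ t ∈ Set.Icc 0 T, HasDerivWithinAt x (f t (x t)) (Set.Icc 0 T) t)
    (hy : ∀ t ∈ Set.Icc 0 T, HasDerivWithinAt y (f t (y t)) (Set.Icc 0 T) t)
    (h0 : x 0 = y 0) : Set.EqOn x y (Set.Icc 0 T) := by
  have key : ∀ z : ℝ → E,
      (∀ t ∈ Set.Icc 0 T, HasDerivWithinAt z (f t (z t)) (Set.Icc 0 T) t) →
      ∀ t ∈ Set.Ico 0 T, HasDerivWithinAt z (f t (z t)) (Set.Ici t) t := fun z hz t ht =>
    (hz t ⟨ht.1, ht.2.le⟩).mono_of_mem_nhdsWithin <| by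
      filter_upwards [Icc_mem_nhdsGE ht.2] with s hs
      exact ⟨ht.1.trans hs.1, hs.2⟩
  exact ODE_solution_unique_of_mem_Icc_right (s := fun _ => Set.univ)
    (fun t ht => (hK t ⟨ht.1, ht.2.le⟩).lipschitzOnWith)
    (fun t ht => (hx t ht).continuousWithinAt) (key x hx) (fun _ _ => trivial)
    (fun t ht => (hy t ht).continuousWithinAt) (key y hy) (fun _ _ => trivial) h0

theorem eq_of_hasDerivWithinAt_Ici {f : ℝ → E → E}
    (hK : ∀ T, 0 ≤ T → ∃ K : NNReal, ∀ t ∈ Set.Icc 0 T, LipschitzWith K (f t)) {x y : ℝ → E}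
    (hx : ∀ t, 0 ≤ t → HasDerivWithinAt x (f t (x t)) (Set.Ici 0) t)
    (hy : ∀ t, 0 ≤ t → HasDerivWithinAt y (f t (y t)) (Set.Ici 0) t)
    (h0 : x 0 = y 0) {t : ℝ} (ht : 0 ≤ t) : x t = y t := by
  obtain ⟨K, hK⟩ := hK t ht
  exact eqOn_of_hasDerivWithinAt_Icc hK (fun s hs => (hx s hs.1).mono fun r hr => hr.1)
    (fun s hs => (hy s hs.1).mono fun r hr => hr.1) h0 ⟨ht, le_rfl⟩

theorem exists_solution_Ici [CompleteSpace E] {f : ℝ → E → E}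
    (hK : ∀ T, 0 ≤ T → ∃ K : NNReal, ∀ t ∈ Set.Icc 0 T, LipschitzWith K (f t))
    (hL : ∀ T, 0 ≤ T → ∃ L : NNReal, ∀ t ∈ Set.Icc 0 T, ∀ x, ‖f t x‖ ≤ L)
    (hc : ∀ x, ContinuousOn (fun t => f t x) (Set.Ici 0)) (x₀ : E) :
    ∃ x : ℝ → E, x 0 = x₀ ∧ ∀ t, 0 ≤ t → HasDerivWithinAt x (f t (x t)) (Set.Ici 0) t := by
  have hloc : ∀ N : ℕ, ∃ x : ℝ → E, x 0 = x₀ ∧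
      ∀ t ∈ Set.Icc (0 : ℝ) N, HasDerivWithinAt x (f t (x t)) (Set.Icc 0 N) t := fun N => by
    obtain ⟨K, hK⟩ := hK N N.cast_nonneg
    obtain ⟨L, hL⟩ := hL N N.cast_nonneg
    -- At speed at most `L` a solution stays in the ball of radius `L * N` up to time `N`, so no
    -- shortening of the interval is needed.
    have h : IsPicardLindelof f (⟨0, by simp⟩ : Set.Icc (0 : ℝ) N) x₀ (L * N) 0 L K :=
      { lipschitzOnWith := fun t ht => (hK t ht).lipschitzOnWith
        continuousOn := fun x _ => (hc x).mono fun t ht => ht.1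
        norm_le := fun t ht x _ => hL t ht x
        mul_max_le := by simp }
    exact h.exists_eq_forall_mem_Icc_hasDerivWithinAt₀
  choose X hX0 hX using hloc
  have hagree : ∀ M N : ℕ, M ≤ N → Set.EqOn (X M) (X N) (Set.Icc 0 M) := fun M N hMN => by
    obtain ⟨K, hK⟩ := hK M M.cast_nonneg
    have hsub : Set.Icc (0 : ℝ) M ⊆ Set.Icc 0 N :=
      Set.Icc_subset_Icc_right (by exact_mod_cast hMN)
    exact eqOn_of_hasDerivWithinAt_Icc hK (hX M)
      (fun t ht => (hX N t (hsub ht)).mono hsub) (by rw [hX0, hX0])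
  have hval : ∀ N : ℕ, ∀ t ∈ Set.Icc (0 : ℝ) N, X (⌊t⌋₊ + 1) t = X N t := fun N t ht => by
    rcases le_total (⌊t⌋₊ + 1) N with h | h
    · exact hagree _ _ h ⟨ht.1, by exact_mod_cast (Nat.lt_floor_add_one t).le⟩
    · exact (hagree _ _ h ht).symm
  -- The `+ 1` puts `t` strictly below the right end of the interval of the chosen solution, which
  -- is therefore defined on a neighbourhood of `t` in the half-line.
  refine ⟨fun t => X (⌊t⌋₊ + 1) t, by simpa using hX0 1, fun t ht => ?_⟩
  set N := ⌊t⌋₊ + 1 with hN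
  have htN : t < N := by simpa [hN] using Nat.lt_floor_add_one t
  have hmem : Set.Icc (0 : ℝ) N ∈ 𝓝[Set.Ici 0] t := by
    filter_upwards [self_mem_nhdsWithin, mem_nhdsWithin_of_mem_nhds (Iio_mem_nhds htN)] with s h1 h2
    exact ⟨h1, le_of_lt h2⟩
  have h1 := (hX N t ⟨ht, htN.le⟩).mono_of_mem_nhdsWithin hmem
  refine h1.congr_of_eventuallyEq ?_ rfl
  filter_upwards [hmem] with s hs using hval N s hs

end GlobalODE

/-! ### The appraisal matrix as a function of the cumulative performances -/

/-- The appraisal matrix reached from `A₀` when the cumulative performances are `y`: the rows of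
`A₀ diag(exp y)`, normalised to unit sum. -/
noncomputable def softAppraisal {n : ℕ} (A₀ : Matrix (Fin n) (Fin n) ℝ) (y : Fin n → ℝ) :
    Matrix (Fin n) (Fin n) ℝ :=
  fun i j => A₀ i j * Real.exp (y j) / ∑ k, A₀ i k * Real.exp (y k)

section SoftAppraisal

variable {n : ℕ} {A₀ : Matrix (Fin n) (Fin n) ℝ}

theorem sum_mul_pos_of_mem_rowStochastic (hA : A₀ ∈ Matrix.rowStochastic ℝ (Fin n))
    {v : Fin n → ℝ} (hv : ∀ i, 0 < v i) (i : Fin n) : 0 < ∑ k, A₀ i k * v k := by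
  have h1 := Matrix.sum_row_of_mem_rowStochastic hA i
  have hnn : ∀ k, 0 ≤ A₀ i k := fun k => hA.1 i k
  have : ∃ k, 0 < A₀ i k := by
    by_contra! h
    have : ∑ j, A₀ i j ≤ 0 := Finset.sum_nonpos fun k _ => h k
    linarith
  obtain ⟨k, hk⟩ := this
  exact Finset.sum_pos' (fun j _ => mul_nonneg (hnn j) (hv j).le)
    ⟨k, Finset.mem_univ k, mul_pos hk (hv k)⟩

theorem sum_mul_exp_pos (hA : A₀ ∈ Matrix.rowStochastic ℝ (Fin n)) (y : Fin n → ℝ) (i : Fin n) :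
    0 < ∑ k, A₀ i k * Real.exp (y k) :=
  sum_mul_pos_of_mem_rowStochastic hA (fun k => Real.exp_pos (y k)) i

theorem softAppraisal_mem_rowStochastic (hA : A₀ ∈ Matrix.rowStochastic ℝ (Fin n))
    (y : Fin n → ℝ) : softAppraisal A₀ y ∈ Matrix.rowStochastic ℝ (Fin n) := by
  refine Matrix.mem_rowStochastic_iff_sum.2 ⟨fun i j => ?_, fun i => ?_⟩
  · exact div_nonneg (mul_nonneg (hA.1 i j) (Real.exp_pos _).le) (sum_mul_exp_pos hA y i).le
  · simp only [softAppraisal]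
    rw [← Finset.sum_div, div_self (sum_mul_exp_pos hA y i).ne']

theorem samePattern_softAppraisal (hA : A₀ ∈ Matrix.rowStochastic ℝ (Fin n)) (y : Fin n → ℝ) :
    SamePattern (softAppraisal A₀ y) A₀ := fun i j => by
  have hD := sum_mul_exp_pos hA y i
  constructor
  · simp [softAppraisal, hD.ne']
  · simp only [softAppraisal]
    rw [div_pos_iff_of_pos_right hD, mul_pos_iff_of_pos_right (Real.exp_pos _)]

theorem softAppraisal_zero (hA : A₀ ∈ Matrix.rowStochastic ℝ (Fin n)) :
    softAppraisal A₀ (fun _ => 0) = A₀ := by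
  ext i j
  simp [softAppraisal, Matrix.sum_row_of_mem_rowStochastic hA i]

/-- Only differences of cumulative performances matter, so `y` may be recentred by whichever scalar
(`z` or `Θ`) keeps it bounded. -/
theorem softAppraisal_sub_const (y : Fin n → ℝ) (c : ℝ) :
    softAppraisal A₀ (fun i => y i - c) = softAppraisal A₀ y := by
  ext i j
  simp only [softAppraisal, Real.exp_sub, ← mul_div_assoc, ← Finset.sum_div]
  rw [div_div_div_cancel_right₀ (Real.exp_pos c).ne']

theorem reducedAppraisal_apply (A₀ : Matrix (Fin n) (Fin n) ℝ) (v : Fin n → ℝ) (i j : Fin n) :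
    reducedAppraisal A₀ v i j = A₀ i j * v j / ∑ k, A₀ i k * v k := by
  simp only [reducedAppraisal, Matrix.mul_diagonal, Matrix.diagonal_mul, Matrix.mulVec, dotProduct]
  ring

theorem reducedAppraisal_exp (y : Fin n → ℝ) (c : ℝ) :
    reducedAppraisal A₀ (fun i => Real.exp (y i - c)) = softAppraisal A₀ y := by
  rw [← softAppraisal_sub_const y c]
  ext i j
  rw [reducedAppraisal_apply, softAppraisal]

/-- Moving `y` by at most `δ` scales the numerator by at least `exp (-δ)` and the denominator by at
most `exp δ`. An entry thus keeps a fraction `exp (-2δ) ≥ 1 - 2δ` of itself, and entries are at most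
one. -/
theorem abs_softAppraisal_sub_le (hA : A₀ ∈ Matrix.rowStochastic ℝ (Fin n)) {y y' : Fin n → ℝ}
    {δ : ℝ} (h : ∀ j, |y j - y' j| ≤ δ) (i j : Fin n) :
    |softAppraisal A₀ y i j - softAppraisal A₀ y' i j| ≤ 2 * δ := by
  have key : ∀ y y' : Fin n → ℝ, (∀ j, |y j - y' j| ≤ δ) →
      softAppraisal A₀ y i j - softAppraisal A₀ y' i j ≤ 2 * δ := fun y y' h => by
    have hδ : 0 ≤ δ := (abs_nonneg _).trans (h j)
    have hS := softAppraisal_mem_rowStochastic hA y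
    have hS0 : 0 ≤ softAppraisal A₀ y i j := hS.1 i j
    have hS1 : softAppraisal A₀ y i j ≤ 1 := Matrix.le_one_of_mem_rowStochastic hS
    have hD := sum_mul_exp_pos hA y i
    have hD' := sum_mul_exp_pos hA y' i
    have hDD : ∑ k, A₀ i k * Real.exp (y' k) ≤ Real.exp δ * ∑ k, A₀ i k * Real.exp (y k) := by
      rw [Finset.mul_sum]
      refine Finset.sum_le_sum fun k _ => ?_
      rw [mul_left_comm, ← Real.exp_add]
      exact mul_le_mul_of_nonneg_left (Real.exp_le_exp.2 (by linarith [(abs_le.1 (h k)).1]))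
        (hA.1 i k)
    have hN : Real.exp (-δ) * (A₀ i j * Real.exp (y j)) ≤ A₀ i j * Real.exp (y' j) := by
      rw [mul_left_comm, ← Real.exp_add]
      exact mul_le_mul_of_nonneg_left (Real.exp_le_exp.2 (by linarith [(abs_le.1 (h j)).2]))
        (hA.1 i j)
    have hN0 : 0 ≤ A₀ i j * Real.exp (y j) := mul_nonneg (hA.1 i j) (Real.exp_pos _).le
    have h2 : Real.exp (-(2 * δ)) * softAppraisal A₀ y i j ≤ softAppraisal A₀ y' i j := by
      have e : Real.exp (-(2 * δ)) * softAppraisal A₀ y i j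
          = Real.exp (-δ) * (A₀ i j * Real.exp (y j)) /
            (Real.exp δ * ∑ k, A₀ i k * Real.exp (y k)) := by
        rw [show -(2 * δ) = -δ - δ by ring, Real.exp_sub, softAppraisal]
        field_simp
      rw [e, softAppraisal]
      exact div_le_div₀ (mul_nonneg (hA.1 i j) (Real.exp_pos _).le) hN hD' hDD
    have h3 := Real.add_one_le_exp (-(2 * δ))
    nlinarith
  rw [abs_sub_le_iff]
  exact ⟨key y y' h, key y' y fun k => by rw [abs_sub_comm]; exact h k⟩

theorem continuous_softAppraisal (hA : A₀ ∈ Matrix.rowStochastic ℝ (Fin n)) (i j : Fin n) :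
    Continuous fun y => softAppraisal A₀ y i j := by
  simp only [softAppraisal]
  refine Continuous.div (by fun_prop) (by fun_prop) fun y => (sum_mul_exp_pos hA y i).ne'

theorem sum_donorFlow {B : Matrix (Fin n) (Fin n) ℝ} (hB : B ∈ Matrix.rowStochastic ℝ (Fin n))
    (w : Fin n → ℝ) : ∑ i, donorFlow B w i = 0 := by
  simp only [donorFlow, Finset.sum_add_distrib, Finset.sum_neg_distrib]
  rw [Finset.sum_comm]
  simp [← Finset.sum_mul, Matrix.sum_row_of_mem_rowStochastic hB]

theorem neg_le_donorFlow {B : Matrix (Fin n) (Fin n) ℝ} (hB : B ∈ Matrix.rowStochastic ℝ (Fin n))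
    {w : Fin n → ℝ} (hw : ∀ i, 0 ≤ w i) (i : Fin n) : -w i ≤ donorFlow B w i := by
  have : 0 ≤ ∑ k, B k i * w k := Finset.sum_nonneg fun k _ => mul_nonneg (hB.1 k i) (hw k)
  simp only [donorFlow]
  linarith

theorem abs_donorFlow_le {B : Matrix (Fin n) (Fin n) ℝ} (hB : B ∈ Matrix.rowStochastic ℝ (Fin n))
    {w : Fin n → ℝ} (hw : ∀ i, 0 ≤ w i) (hw1 : ∀ i, w i ≤ 1) (i : Fin n) :
    |donorFlow B w i| ≤ 1 + n := by
  have h1 := neg_le_donorFlow hB hw i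
  have h2 : ∑ k, B k i * w k ≤ ∑ _k : Fin n, (1 : ℝ) := Finset.sum_le_sum fun k _ =>
    mul_le_one₀ (Matrix.le_one_of_mem_rowStochastic hB) (hw k) (hw1 k)
  simp only [Finset.sum_const, Finset.card_univ, Fintype.card_fin, nsmul_eq_mul, mul_one] at h2
  have h3 : (0 : ℝ) ≤ n := n.cast_nonneg
  rw [abs_le]
  refine ⟨by linarith [hw1 i], ?_⟩
  simp only [donorFlow]
  linarith [hw i]

theorem abs_donorFlow_sub_le {B B' : Matrix (Fin n) (Fin n) ℝ}
    (hB' : B' ∈ Matrix.rowStochastic ℝ (Fin n))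
    {w w' : Fin n → ℝ} (hw : ∀ i, 0 ≤ w i) (hw1 : ∀ i, w i ≤ 1) {δ ε : ℝ}
    (hBB : ∀ i j, |B i j - B' i j| ≤ ε) (hww : ∀ i, |w i - w' i| ≤ δ) (i : Fin n) :
    |donorFlow B w i - donorFlow B' w' i| ≤ δ + n * (ε + δ) := by
  have e : donorFlow B w i - donorFlow B' w' i
      = -(w i - w' i) + ∑ k, ((B k i - B' k i) * w k + B' k i * (w k - w' k)) := by
    simp only [donorFlow]
    rw [show ∑ k, ((B k i - B' k i) * w k + B' k i * (w k - w' k))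
      = ∑ k, B k i * w k - ∑ k, B' k i * w' k by
        rw [← Finset.sum_sub_distrib]; exact Finset.sum_congr rfl fun k _ => by ring]
    ring
  have hsum : |∑ k, ((B k i - B' k i) * w k + B' k i * (w k - w' k))| ≤ n * (ε + δ) := by
    refine (Finset.abs_sum_le_sum_abs _ _).trans ?_
    refine (Finset.sum_le_card_nsmul _ _ (ε + δ) fun k _ => ?_).trans (by simp [mul_add])
    refine (abs_add_le _ _).trans (add_le_add ?_ ?_)
    · rw [abs_mul, abs_of_nonneg (hw k)]
      exact (mul_le_of_le_one_right (abs_nonneg _) (hw1 k)).trans (hBB k i)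
    · rw [abs_mul, abs_of_nonneg (hB'.1 k i)]
      exact (mul_le_of_le_one_left (abs_nonneg _)
        (Matrix.le_one_of_mem_rowStochastic hB')).trans (hww k)
  rw [e]
  refine (abs_add_le _ _).trans (add_le_add ?_ hsum)
  rw [abs_neg]
  exact hww i

end SoftAppraisal

/-! ### Trajectories in the cumulative performances -/

theorem intSimplex_le_one {n : ℕ} {w : Fin n → ℝ} (hw : w ∈ intSimplex n) (i : Fin n) :
    w i ≤ 1 := by
  rw [← hw.2]
  exact Finset.single_le_sum (fun k _ => (hw.1 k).le) (Finset.mem_univ i)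

theorem intSimplex_mem_Ioc {n : ℕ} {w : Fin n → ℝ} (hw : w ∈ intSimplex n) (i : Fin n) :
    w i ∈ Set.Ioc (0 : ℝ) 1 := ⟨hw.1 i, intSimplex_le_one hw i⟩

/-- `(y, w)` solves `y' = p(w)`, `w' = -w + (softAppraisal A₀ y)ᵀ w` on `[0, ∞)` with initial
condition `(0, w₀)` and `w` in the relative interior of the simplex. -/
structure IsCumulativeTrajectory {n : ℕ} (p : Fin n → ℝ → ℝ)
    (A₀ : Matrix (Fin n) (Fin n) ℝ) (w₀ : Fin n → ℝ) (y w : ℝ → Fin n → ℝ) : Prop where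
  init_y : y 0 = fun _ => 0
  init_w : w 0 = w₀
  mem_w : ∀ t, 0 ≤ t → w t ∈ intSimplex n
  deriv_y : ∀ t, 0 ≤ t → ∀ i,
    HasDerivWithinAt (fun s => y s i) (p i (w t i)) (Set.Ici 0) t
  deriv_w : ∀ t, 0 ≤ t → ∀ i,
    HasDerivWithinAt (fun s => w s i) (donorFlow (softAppraisal A₀ (y t)) (w t) i) (Set.Ici 0) t

/-- Truncation of a real number to `[a, 1]`. -/
noncomputable def truncTo (a x : ℝ) : ℝ := max a (min x 1)

theorem truncTo_eq_self {a x : ℝ} (h : a ≤ x) (h1 : x ≤ 1) : truncTo a x = x := by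
  simp [truncTo, min_eq_left h1, max_eq_right h]

theorem le_truncTo (a x : ℝ) : a ≤ truncTo a x := le_max_left _ _

theorem truncTo_le_one {a : ℝ} (x : ℝ) (h : a ≤ 1) : truncTo a x ≤ 1 :=
  max_le h (min_le_right _ _)

theorem abs_truncTo_sub_le (a x y : ℝ) : |truncTo a x - truncTo a y| ≤ |x - y| := by
  simp only [truncTo]
  rw [max_comm a, max_comm a]
  refine (abs_max_sub_max_le_abs _ _ _).trans ?_
  simpa using abs_min_sub_min_le_max x 1 y 1

theorem exists_lipschitz_of_isPerformanceFunction {f : ℝ → ℝ} (hf : IsPerformanceFunction f)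
    {a : ℝ} (ha : 0 < a) : ∃ K : NNReal, LipschitzOnWith K f (Set.Icc a 1) := by
  have hsub : Set.Icc a 1 ⊆ Set.Ioc 0 1 := fun x hx => ⟨ha.trans_le hx.1, hx.2⟩
  have := (hf.contDiffOn.mono hsub).locallyLipschitzOn (convex_Icc a 1)
  exact this.exists_lipschitzOnWith_of_compact isCompact_Icc

/-- The field of the cumulative dynamics, truncated so as to be bounded and Lipschitz on bounded
time intervals. -/
noncomputable def truncField {n : ℕ} (p : Fin n → ℝ → ℝ) (A₀ : Matrix (Fin n) (Fin n) ℝ) (ε t : ℝ)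
    (z : (Fin n → ℝ) × (Fin n → ℝ)) : (Fin n → ℝ) × (Fin n → ℝ) :=
  (fun i => p i (truncTo (ε * Real.exp (-2 * t)) (z.2 i)),
    donorFlow (softAppraisal A₀ z.1) fun k => truncTo 0 (z.2 k))

section TruncField

variable {n : ℕ} {p : Fin n → ℝ → ℝ} {A₀ : Matrix (Fin n) (Fin n) ℝ} {ε : ℝ}

theorem trunc_level_mem (hε : 0 < ε) (hε1 : ε ≤ 1) {t T : ℝ} (ht : t ∈ Set.Icc 0 T) :
    ε * Real.exp (-2 * T) ≤ ε * Real.exp (-2 * t) ∧ ε * Real.exp (-2 * t) ≤ 1 := by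
  constructor
  · exact mul_le_mul_of_nonneg_left (Real.exp_le_exp.2 (by linarith [ht.2])) hε.le
  · exact mul_le_one₀ hε1 (Real.exp_pos _).le (Real.exp_le_one_iff.2 (by linarith [ht.1]))

theorem truncField_lipschitz (hp : IsPerformanceFamily p)
    (hA : A₀ ∈ Matrix.rowStochastic ℝ (Fin n)) (hε : 0 < ε) (hε1 : ε ≤ 1) (T : ℝ) :
    ∃ K : NNReal, ∀ t ∈ Set.Icc 0 T, LipschitzWith K (truncField p A₀ ε t) := by
  have hlo : 0 < ε * Real.exp (-2 * T) := mul_pos hε (Real.exp_pos _)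
  choose K hK using fun i => exists_lipschitz_of_isPerformanceFunction (hp.each i) hlo
  refine ⟨∑ i, K i + (1 + 3 * n), fun t ht => LipschitzWith.of_dist_le_mul fun z z' => ?_⟩
  obtain ⟨h1, h2⟩ := trunc_level_mem hε hε1 ht
  have hd1 : ∀ i, |z.1 i - z'.1 i| ≤ dist z z' := fun i =>
    (dist_le_pi_dist z.1 z'.1 i).trans (le_max_left _ _)
  have hd2 : ∀ i, |z.2 i - z'.2 i| ≤ dist z z' := fun i =>
    (dist_le_pi_dist z.2 z'.2 i).trans (le_max_right _ _)
  have hnn : 0 ≤ dist z z' := dist_nonneg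
  have hS : (0 : ℝ) ≤ ∑ i, (K i : ℝ) := Finset.sum_nonneg fun i _ => (K i).2
  have hn0 : (0 : ℝ) ≤ n := n.cast_nonneg
  push_cast
  refine max_le ((dist_pi_le_iff (by positivity)).2 fun i => ?_)
    ((dist_pi_le_iff (by positivity)).2 fun i => ?_)
  · refine ((hK i).dist_le_mul _ ⟨h1.trans (le_truncTo _ _), truncTo_le_one _ h2⟩ _
      ⟨h1.trans (le_truncTo _ _), truncTo_le_one _ h2⟩).trans ?_
    refine mul_le_mul ?_ ((abs_truncTo_sub_le _ _ _).trans (hd2 i)) dist_nonneg (by positivity)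
    have : (K i : ℝ) ≤ ∑ i, (K i : ℝ) :=
      Finset.single_le_sum (f := fun i => (K i : ℝ)) (fun i _ => (K i).2) (Finset.mem_univ i)
    linarith
  · have := abs_donorFlow_sub_le (softAppraisal_mem_rowStochastic hA z'.1)
      (w := fun k => truncTo 0 (z.2 k)) (w' := fun k => truncTo 0 (z'.2 k))
      (fun k => le_truncTo _ _) (fun k => truncTo_le_one _ zero_le_one)
      (abs_softAppraisal_sub_le hA hd1)
      (fun k => (abs_truncTo_sub_le _ _ _).trans (hd2 k)) i
    rw [Real.dist_eq]
    refine this.trans ?_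
    nlinarith [mul_nonneg hS hnn]

theorem truncField_bounded (hp : IsPerformanceFamily p)
    (hA : A₀ ∈ Matrix.rowStochastic ℝ (Fin n)) (hε : 0 < ε) (hε1 : ε ≤ 1) {T : ℝ} (hT : 0 ≤ T) :
    ∃ L : NNReal, ∀ t ∈ Set.Icc 0 T, ∀ z, ‖truncField p A₀ ε t z‖ ≤ L := by
  have hlo : 0 < ε * Real.exp (-2 * T) := mul_pos hε (Real.exp_pos _)
  have hlo1 := (trunc_level_mem hε hε1 (Set.right_mem_Icc.2 hT)).2
  have hpos : ∀ i, 0 ≤ p i (ε * Real.exp (-2 * T)) := fun i => (hp.each i).nonneg _ ⟨hlo, hlo1⟩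
  have hS : (0 : ℝ) ≤ ∑ i, p i (ε * Real.exp (-2 * T)) := Finset.sum_nonneg fun i _ => hpos i
  have hn0 : (0 : ℝ) ≤ n := n.cast_nonneg
  refine ⟨Real.toNNReal (∑ i, p i (ε * Real.exp (-2 * T)) + (1 + n)), fun t ht z => ?_⟩
  obtain ⟨h1, h2⟩ := trunc_level_mem hε hε1 ht
  rw [Real.coe_toNNReal _ (by positivity)]
  refine max_le ((pi_norm_le_iff_of_nonneg (by positivity)).2 fun i => ?_)
    ((pi_norm_le_iff_of_nonneg (by positivity)).2 fun i => ?_)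
  · have hm : truncTo (ε * Real.exp (-2 * t)) (z.2 i) ∈ Set.Ioc (0 : ℝ) 1 :=
      ⟨hlo.trans_le (h1.trans (le_truncTo _ _)), truncTo_le_one _ h2⟩
    simp only [truncField]
    rw [Real.norm_of_nonneg ((hp.each i).nonneg _ hm)]
    refine ((hp.each i).strictAntiOn.antitoneOn ⟨hlo, hlo1⟩ hm
      (h1.trans (le_truncTo _ _))).trans ?_
    have := Finset.single_le_sum (f := fun i => p i (ε * Real.exp (-2 * T)))
      (fun i _ => hpos i) (Finset.mem_univ i)
    linarith
  · have := abs_donorFlow_le (softAppraisal_mem_rowStochastic hA z.1)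
      (w := fun k => truncTo 0 (z.2 k)) (fun k => le_truncTo _ _)
      (fun k => truncTo_le_one _ zero_le_one) i
    simp only [truncField, Real.norm_eq_abs]
    linarith

theorem truncField_continuous_time (hp : IsPerformanceFamily p) (hε : 0 < ε) (hε1 : ε ≤ 1)
    (z : (Fin n → ℝ) × (Fin n → ℝ)) :
    ContinuousOn (fun t => truncField p A₀ ε t z) (Set.Ici 0) := by
  refine ContinuousOn.prodMk (continuousOn_pi.2 fun i => ?_) continuousOn_const
  refine (hp.each i).contDiffOn.continuousOn.comp ?_ fun t ht => ?_
  · unfold truncTo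
    fun_prop
  · exact ⟨(mul_pos hε (Real.exp_pos _)).trans_le (le_truncTo _ _),
      truncTo_le_one _ (trunc_level_mem hε hε1 ⟨ht, le_refl t⟩).2⟩

/-- A function that decays at rate at most `1` where it meets the barrier `ε exp(-2t)` stays above
this barrier. -/
theorem exp_barrier_le {f f' : ℝ → ℝ} (hε : 0 < ε) (h0 : ε ≤ f 0)
    (hf : ∀ t, 0 ≤ t → HasDerivWithinAt f (f' t) (Set.Ici 0) t)
    (hf' : ∀ t, 0 ≤ t → f t = ε * Real.exp (-2 * t) → -f t ≤ f' t) {t : ℝ} (ht : 0 ≤ t) :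
    ε * Real.exp (-2 * t) ≤ f t := by
  have hB : ∀ x, HasDerivAt (fun x => -(ε * Real.exp (-2 * x)))
      (2 * (ε * Real.exp (-2 * x))) x := fun x => by
    have := (((hasDerivAt_id x).const_mul (-2)).exp.const_mul ε).neg
    refine this.congr_deriv ?_
    simp only [id]
    ring
  have := image_le_of_deriv_right_lt_deriv_boundary (f := fun x => -f x) (f' := fun x => -f' x)
    (a := 0) (b := t) (B := fun x => -(ε * Real.exp (-2 * x)))
    (fun x hx => ((hf x hx.1).continuousWithinAt.mono fun y hy => hy.1).neg)
    (fun x hx => ((hf x hx.1).mono fun y hy => hx.1.trans hy).neg) (by simpa using h0) hB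
    (fun x hx hxe => ?_) ⟨ht, le_refl t⟩
  · simpa using this
  -- Barrier rate 2 against decay rate 1 gives the strict inequality required at a contact point.
  · have h1 : f x = ε * Real.exp (-2 * x) := neg_injective hxe
    have h2 := hf' x hx.1 h1
    have h3 : 0 < ε * Real.exp (-2 * x) := mul_pos hε (Real.exp_pos _)
    linarith

/-- The barrier bounds `w` below and the simplex bounds it above, so the truncation never acts.
Uniqueness for the singular system is thereby inherited from a Lipschitz one. -/
theorem IsCumulativeTrajectory.hasDerivWithinAt_truncField {w₀ : Fin n → ℝ}
    {y w : ℝ → Fin n → ℝ} (hA : A₀ ∈ Matrix.rowStochastic ℝ (Fin n))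
    (h : IsCumulativeTrajectory p A₀ w₀ y w) (hε : 0 < ε) (hεw : ∀ i, ε ≤ w₀ i) {t : ℝ}
    (ht : 0 ≤ t) :
    HasDerivWithinAt (fun t => (y t, w t)) (truncField p A₀ ε t (y t, w t)) (Set.Ici 0) t := by
  refine HasDerivWithinAt.prodMk (hasDerivWithinAt_pi.2 fun i => ?_)
    (hasDerivWithinAt_pi.2 fun i => ?_)
  · have hlow := exp_barrier_le hε (f := fun t => w t i) (by simpa [h.init_w] using hεw i)
      (fun s hs => h.deriv_w s hs i) (fun s hs _ => neg_le_donorFlow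
        (softAppraisal_mem_rowStochastic hA _) (fun k => ((h.mem_w s hs).1 k).le) i) ht
    rw [truncTo_eq_self hlow (intSimplex_le_one (h.mem_w t ht) i)]
    exact h.deriv_y t ht i
  · have : (fun k => truncTo 0 (w t k)) = w t := funext fun k =>
      truncTo_eq_self ((h.mem_w t ht).1 k).le (intSimplex_le_one (h.mem_w t ht) k)
    simp only
    rw [this]
    exact h.deriv_w t ht i

end TruncField

theorem intSimplex_exists_lower {n : ℕ} (hn : 1 ≤ n) {w₀ : Fin n → ℝ} (hw : w₀ ∈ intSimplex n) :
    ∃ ε, 0 < ε ∧ ε ≤ 1 ∧ ∀ i, ε ≤ w₀ i := by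
  have : Nonempty (Fin n) := ⟨⟨0, hn⟩⟩
  obtain ⟨i, hi⟩ := Finite.exists_min w₀
  exact ⟨w₀ i, hw.1 i, intSimplex_le_one hw i, hi⟩

theorem IsCumulativeTrajectory.unique {n : ℕ} (hn : 1 ≤ n) {p : Fin n → ℝ → ℝ}
    (hp : IsPerformanceFamily p) {A₀ : Matrix (Fin n) (Fin n) ℝ}
    (hA : A₀ ∈ Matrix.rowStochastic ℝ (Fin n)) {w₀ : Fin n → ℝ} (hw₀ : w₀ ∈ intSimplex n)
    {y w y' w' : ℝ → Fin n → ℝ} (h : IsCumulativeTrajectory p A₀ w₀ y w)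
    (h' : IsCumulativeTrajectory p A₀ w₀ y' w') {t : ℝ} (ht : 0 ≤ t) :
    y t = y' t ∧ w t = w' t := by
  obtain ⟨ε, hε, hε1, hεw⟩ := intSimplex_exists_lower hn hw₀
  have := eq_of_hasDerivWithinAt_Ici (f := truncField p A₀ ε)
    (fun T _ => truncField_lipschitz hp hA hε hε1 T)
    (fun s hs => h.hasDerivWithinAt_truncField hA hε hεw hs)
    (fun s hs => h'.hasDerivWithinAt_truncField hA hε hεw hs)
    (by rw [h.init_y, h.init_w, h'.init_y, h'.init_w]) ht
  exact Prod.ext_iff.1 this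

theorem exists_isCumulativeTrajectory {n : ℕ} (hn : 1 ≤ n) {p : Fin n → ℝ → ℝ}
    (hp : IsPerformanceFamily p) {A₀ : Matrix (Fin n) (Fin n) ℝ}
    (hA : A₀ ∈ Matrix.rowStochastic ℝ (Fin n)) {w₀ : Fin n → ℝ} (hw₀ : w₀ ∈ intSimplex n) :
    ∃ y w, IsCumulativeTrajectory p A₀ w₀ y w := by
  obtain ⟨ε, hε, hε1, hεw⟩ := intSimplex_exists_lower hn hw₀
  obtain ⟨z, hz0, hz⟩ := exists_solution_Ici (f := truncField p A₀ ε)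
    (fun T _ => truncField_lipschitz hp hA hε hε1 T)
    (fun T hT => truncField_bounded hp hA hε hε1 hT)
    (truncField_continuous_time hp hε hε1) ((fun _ => 0), w₀)
  have hy : ∀ t, 0 ≤ t → ∀ i, HasDerivWithinAt (fun s => (z s).1 i)
      ((truncField p A₀ ε t (z t)).1 i) (Set.Ici 0) t := fun t ht i =>
    hasDerivWithinAt_pi.1 (hasFDerivAt_fst.comp_hasDerivWithinAt t (hz t ht)) i
  have hw : ∀ t, 0 ≤ t → ∀ i, HasDerivWithinAt (fun s => (z s).2 i)
      ((truncField p A₀ ε t (z t)).2 i) (Set.Ici 0) t := fun t ht i =>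
    hasDerivWithinAt_pi.1 (hasFDerivAt_snd.comp_hasDerivWithinAt t (hz t ht)) i
  have hS : ∀ t, softAppraisal A₀ (z t).1 ∈ Matrix.rowStochastic ℝ (Fin n) := fun t =>
    softAppraisal_mem_rowStochastic hA _
  have hlow : ∀ t, 0 ≤ t → ∀ i, ε * Real.exp (-2 * t) ≤ (z t).2 i := fun t ht i => by
    refine exp_barrier_le hε (f := fun t => (z t).2 i) (by simpa [hz0] using hεw i)
      (fun s hs => hw s hs i) (fun s hs hse => ?_) ht
    have h1 := neg_le_donorFlow (hS s) (w := fun k => truncTo 0 ((z s).2 k))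
      (fun k => le_truncTo _ _) i
    have h2 : truncTo 0 ((z s).2 i) = (z s).2 i := by
      refine truncTo_eq_self ?_ ?_
      · rw [hse]; positivity
      · rw [hse]; exact (trunc_level_mem hε hε1 ⟨hs, le_refl s⟩).2
    simp only [h2] at h1
    exact h1
  have hmem : ∀ t, 0 ≤ t → (z t).2 ∈ intSimplex n := fun t ht => by
    refine ⟨fun i => (mul_pos hε (Real.exp_pos _)).trans_le (hlow t ht i), ?_⟩
    -- The flow out of a row-stochastic matrix has zero sum on every vector, in particular on the
    -- truncated one. The bound `w i ≤ 1` then follows from positivity and unit sum.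
    have hd : ∀ s, 0 ≤ s → HasDerivWithinAt (fun s => ∑ i, (z s).2 i) 0 (Set.Ici 0) s :=
      fun s hs => by
        have := HasDerivWithinAt.fun_sum (u := Finset.univ) fun i _ => hw s hs i
        refine this.congr_deriv ?_
        exact sum_donorFlow (hS s) _
    have := eq_of_hasDerivWithinAt_zero_Ici hd ht
    rw [this, hz0]
    exact hw₀.2
  refine ⟨fun t => (z t).1, fun t => (z t).2, by simp [hz0], by simp [hz0], hmem,
    fun t ht i => ?_, fun t ht i => ?_⟩
  · refine (hy t ht i).congr_deriv ?_
    simp only [truncField]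
    rw [truncTo_eq_self (hlow t ht i) (intSimplex_le_one (hmem t ht) i)]
  · refine (hw t ht i).congr_deriv ?_
    have : (fun k => truncTo 0 ((z t).2 k)) = (z t).2 := funext fun k =>
      truncTo_eq_self ((hmem t ht).1 k).le (intSimplex_le_one (hmem t ht) k)
    simp only [truncField]
    rw [this]

/-! ### Appraisal and reduced-order trajectories through the cumulative performances -/

section Conversion

variable {n : ℕ} {p : Fin n → ℝ → ℝ} {A₀ : Matrix (Fin n) (Fin n) ℝ} {w₀ : Fin n → ℝ}

theorem continuousOn_performance (hp : IsPerformanceFamily p) {w : ℝ → Fin n → ℝ} {i : Fin n}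
    (hc : ContinuousOn (fun t => w t i) (Set.Ici 0))
    (hw : ∀ t, 0 ≤ t → w t i ∈ Set.Ioc (0 : ℝ) 1) :
    ContinuousOn (fun t => p i (w t i)) (Set.Ici 0) :=
  (hp.each i).contDiffOn.continuousOn.comp hc fun t ht => hw t ht

theorem exists_cumulative_performance (hp : IsPerformanceFamily p) {w : ℝ → Fin n → ℝ}
    (hc : ∀ i, ContinuousOn (fun t => w t i) (Set.Ici 0))
    (hw : ∀ t, 0 ≤ t → ∀ i, w t i ∈ Set.Ioc (0 : ℝ) 1) :
    ∃ y : ℝ → Fin n → ℝ, (y 0 = fun _ => 0) ∧ ∀ t, 0 ≤ t → ∀ i,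
      HasDerivWithinAt (fun s => y s i) (p i (w t i)) (Set.Ici 0) t := by
  choose Y hY0 hY using fun i => exists_antiderivative_Ici
    (continuousOn_performance hp (hc i) fun t ht => hw t ht i)
  exact ⟨fun t i => Y i t, funext hY0, fun t ht i => hY i t ht⟩

/-- Integrating the replicator equation entrywise gives `A₀ i j * exp (y j - Φ i)`, where `Φ i`
depends on the row alone; unit row sums then force `exp (Φ i)` to be the normalising factor. -/
theorem IsASAPTrajectory.exists_cumulative (hp : IsPerformanceFamily p)
    (hA : A₀ ∈ Matrix.rowStochastic ℝ (Fin n)) (hw₀ : w₀ ∈ intSimplex n)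
    {A : ℝ → Matrix (Fin n) (Fin n) ℝ} {w : ℝ → Fin n → ℝ} (h : IsASAPTrajectory p A₀ w₀ A w) :
    ∃ y, IsCumulativeTrajectory p A₀ w₀ y w ∧ ∀ t, 0 ≤ t → A t = softAppraisal A₀ (y t) := by
  have hcw : ∀ i, ContinuousOn (fun t => w t i) (Set.Ici 0) := fun i t ht =>
    (h.deriv_w t ht i).continuousWithinAt
  have hcA : ∀ i j, ContinuousOn (fun t => A t i j) (Set.Ici 0) := fun i j t ht =>
    (h.deriv_A t ht i j).continuousWithinAt
  have hcp : ∀ i, ContinuousOn (fun t => p i (w t i)) (Set.Ici 0) := fun i =>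
    continuousOn_performance hp (hcw i) fun t ht => h.mem_domain t ht i
  obtain ⟨y, hy0, hy⟩ := exists_cumulative_performance hp hcw h.mem_domain
  choose Φ hΦ0 hΦ using fun i => exists_antiderivative_Ici
    (continuousOn_finsetSum Finset.univ fun k _ => (hcA i k).mul (hcp k))
  have hform : ∀ t, 0 ≤ t → ∀ i j, A t i j = A₀ i j * Real.exp (y t j - Φ i t) :=
    fun t ht i j => by
      have := eq_mul_exp_of_hasDerivWithinAt (fun s hs => h.deriv_A s hs i j)
        (fun s hs => (hy s hs j).fun_sub (hΦ i s hs)) (by simp [hy0, hΦ0]) ht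
      rwa [h.init_A] at this
  have hrow : ∀ t, 0 ≤ t → ∀ i, ∑ j, A t i j = 1 := fun t ht i => by
    -- The row-sum defect solves a homogeneous linear equation and vanishes initially, so it
    -- vanishes throughout.
    have hd : ∀ s, 0 ≤ s → HasDerivWithinAt (fun s => 1 - ∑ j, A s i j)
        ((1 - ∑ j, A s i j) * -∑ k, A s i k * p k (w s k)) (Set.Ici 0) s := fun s hs => by
      refine ((HasDerivWithinAt.fun_sum (u := Finset.univ)
        fun j _ => h.deriv_A s hs i j).const_sub 1).congr_deriv ?_
      simp only [appraisalField, mul_sub, Finset.sum_sub_distrib, ← Finset.sum_mul]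
      ring
    have := eq_mul_exp_of_hasDerivWithinAt hd (fun s hs => (hΦ i s hs).fun_neg)
      (by simp [hΦ0]) ht
    rw [h.init_A, Matrix.sum_row_of_mem_rowStochastic hA i] at this
    linarith
  have hsoft : ∀ t, 0 ≤ t → A t = softAppraisal A₀ (y t) := fun t ht => by
    ext i j
    have h1 := hrow t ht i
    simp only [hform t ht, Real.exp_sub, ← mul_div_assoc, ← Finset.sum_div] at h1
    rw [div_eq_one_iff_eq (Real.exp_pos _).ne'] at h1
    rw [hform t ht, softAppraisal, h1, Real.exp_sub, mul_div_assoc]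
  refine ⟨y, ⟨hy0, h.init_w, fun t ht => ⟨fun i => (h.mem_domain t ht i).1, ?_⟩, hy,
    fun t ht i => by rw [← hsoft t ht]; exact h.deriv_w t ht i⟩, hsoft⟩
  have hd : ∀ s, 0 ≤ s → HasDerivWithinAt (fun s => ∑ i, w s i) 0 (Set.Ici 0) s :=
    fun s hs => by
      refine (HasDerivWithinAt.fun_sum (u := Finset.univ)
        fun i _ => h.deriv_w s hs i).congr_deriv ?_
      rw [hsoft s hs]
      exact sum_donorFlow (softAppraisal_mem_rowStochastic hA _) _
  rw [eq_of_hasDerivWithinAt_zero_Ici hd ht, h.init_w, hw₀.2]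

theorem hasDerivWithinAt_softAppraisal (hA : A₀ ∈ Matrix.rowStochastic ℝ (Fin n))
    {y : ℝ → Fin n → ℝ} {q : Fin n → ℝ} {s : Set ℝ} {t : ℝ}
    (hy : ∀ i, HasDerivWithinAt (fun s => y s i) (q i) s t) (i j : Fin n) :
    HasDerivWithinAt (fun s => softAppraisal A₀ (y s) i j)
      (softAppraisal A₀ (y t) i j * (q j - ∑ k, softAppraisal A₀ (y t) i k * q k)) s t := by
  have hD := sum_mul_exp_pos hA (y t) i
  have hN : ∀ j, HasDerivWithinAt (fun s => A₀ i j * Real.exp (y s j))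
      (A₀ i j * (Real.exp (y t j) * q j)) s t := fun j => (hy j).exp.const_mul _
  refine ((hN j).fun_div (HasDerivWithinAt.fun_sum (u := Finset.univ) fun k _ => hN k)
    hD.ne').congr_deriv ?_
  have e : ∑ k, softAppraisal A₀ (y t) i k * q k
      = (∑ k, A₀ i k * (Real.exp (y t k) * q k)) / ∑ k, A₀ i k * Real.exp (y t k) := by
    rw [Finset.sum_div]
    exact Finset.sum_congr rfl fun k _ => by rw [softAppraisal]; ring
  rw [e, softAppraisal]
  field_simp

theorem IsCumulativeTrajectory.isASAPTrajectory (hA : A₀ ∈ Matrix.rowStochastic ℝ (Fin n))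
    {y w : ℝ → Fin n → ℝ} (h : IsCumulativeTrajectory p A₀ w₀ y w) :
    IsASAPTrajectory p A₀ w₀ (fun t => softAppraisal A₀ (y t)) w where
  init_A := by rw [h.init_y, softAppraisal_zero hA]
  init_w := h.init_w
  mem_domain t ht := intSimplex_mem_Ioc (h.mem_w t ht)
  deriv_A t ht := hasDerivWithinAt_softAppraisal hA (h.deriv_y t ht)
  deriv_w := h.deriv_w

theorem IsCumulativeTrajectory.continuousOn_w {y w : ℝ → Fin n → ℝ}
    (h : IsCumulativeTrajectory p A₀ w₀ y w) (i : Fin n) :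
    ContinuousOn (fun t => w t i) (Set.Ici 0) := fun t ht =>
  (h.deriv_w t ht i).continuousWithinAt

theorem IsCumulativeTrajectory.continuousOn_y {y w : ℝ → Fin n → ℝ}
    (h : IsCumulativeTrajectory p A₀ w₀ y w) : ContinuousOn y (Set.Ici 0) :=
  continuousOn_pi.2 fun i t ht => (h.deriv_y t ht i).continuousWithinAt

theorem IsCumulativeTrajectory.continuousOn_performance (hp : IsPerformanceFamily p)
    {y w : ℝ → Fin n → ℝ} (h : IsCumulativeTrajectory p A₀ w₀ y w) (i : Fin n) :
    ContinuousOn (fun t => p i (w t i)) (Set.Ici 0) :=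
  _root_.continuousOn_performance hp (h.continuousOn_w i)
    fun t ht => intSimplex_mem_Ioc (h.mem_w t ht) i

theorem IsCumulativeTrajectory.exists_antiderivative (hp : IsPerformanceFamily p)
    (hA : A₀ ∈ Matrix.rowStochastic ℝ (Fin n))
    {y w : ℝ → Fin n → ℝ} (h : IsCumulativeTrajectory p A₀ w₀ y w) :
    ∃ Θ : ℝ → ℝ, Θ 0 = 0 ∧ ∀ t, 0 ≤ t → HasDerivWithinAt Θ
      (w t ⬝ᵥ (softAppraisal A₀ (y t)).mulVec (perf p (w t))) (Set.Ici 0) t := by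
  refine exists_antiderivative_Ici ?_
  simp only [dotProduct, Matrix.mulVec, perf]
  refine continuousOn_finsetSum _ fun i _ => (h.continuousOn_w i).mul
    (continuousOn_finsetSum _ fun j _ => ContinuousOn.mul ?_ (h.continuousOn_performance hp j))
  exact (continuous_softAppraisal hA i j).comp_continuousOn h.continuousOn_y

theorem IsCumulativeTrajectory.isReducedTrajectory
    {y w : ℝ → Fin n → ℝ} (h : IsCumulativeTrajectory p A₀ w₀ y w) {Θ : ℝ → ℝ} (hΘ0 : Θ 0 = 0)
    (hΘ : ∀ t, 0 ≤ t → HasDerivWithinAt Θ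
      (w t ⬝ᵥ (softAppraisal A₀ (y t)).mulVec (perf p (w t))) (Set.Ici 0) t) :
    IsReducedTrajectory p A₀ w₀ (fun t i => Real.exp (y t i - Θ t)) w where
  init_v := by simp [h.init_y, hΘ0]
  init_w := h.init_w
  pos_v t _ i := Real.exp_pos _
  mem_w := h.mem_w
  deriv_v t ht i := by
    rw [reducedAppraisal_exp]
    refine ((h.deriv_y t ht i).fun_sub (hΘ t ht)).exp.congr_deriv ?_
    simp only [perf]
    ring
  deriv_w t ht i := by
    rw [reducedAppraisal_exp]
    exact h.deriv_w t ht i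

theorem IsReducedTrajectory.exists_cumulative (hp : IsPerformanceFamily p)
    (hA : A₀ ∈ Matrix.rowStochastic ℝ (Fin n)) {v w : ℝ → Fin n → ℝ}
    (h : IsReducedTrajectory p A₀ w₀ v w) :
    ∃ y Θ, IsCumulativeTrajectory p A₀ w₀ y w ∧ Θ 0 = 0 ∧
      (∀ t, 0 ≤ t → HasDerivWithinAt Θ
        (w t ⬝ᵥ (softAppraisal A₀ (y t)).mulVec (perf p (w t))) (Set.Ici 0) t) ∧
      ∀ t, 0 ≤ t → ∀ i, v t i = Real.exp (y t i - Θ t) := by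
  have hcw : ∀ i, ContinuousOn (fun t => w t i) (Set.Ici 0) := fun i t ht =>
    (h.deriv_w t ht i).continuousWithinAt
  have hcv : ∀ i, ContinuousOn (fun t => v t i) (Set.Ici 0) := fun i t ht =>
    (h.deriv_v t ht i).continuousWithinAt
  have hdom : ∀ t, 0 ≤ t → ∀ i, w t i ∈ Set.Ioc (0 : ℝ) 1 := fun t ht =>
    intSimplex_mem_Ioc (h.mem_w t ht)
  obtain ⟨y, hy0, hy⟩ := exists_cumulative_performance hp hcw hdom
  have hcθ : ContinuousOn
      (fun t => w t ⬝ᵥ (reducedAppraisal A₀ (v t)).mulVec (perf p (w t))) (Set.Ici 0) := by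
    simp only [dotProduct, Matrix.mulVec, perf, reducedAppraisal_apply]
    refine continuousOn_finsetSum _ fun i _ => (hcw i).mul
      (continuousOn_finsetSum _ fun j _ => ContinuousOn.mul ?_
        (continuousOn_performance hp (hcw j) fun t ht => hdom t ht j))
    refine (continuousOn_const.mul (hcv j)).div
      (continuousOn_finsetSum _ fun k _ => continuousOn_const.mul (hcv k)) fun t ht => ?_
    exact (sum_mul_pos_of_mem_rowStochastic hA (h.pos_v t ht) i).ne'
  obtain ⟨Θ, hΘ0, hΘ⟩ := exists_antiderivative_Ici hcθ
  have hv : ∀ t, 0 ≤ t → ∀ i, v t i = Real.exp (y t i - Θ t) := fun t ht i => by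
    have := eq_mul_exp_of_hasDerivWithinAt
      (fun s hs => (h.deriv_v s hs i).congr_deriv (mul_comm _ _))
      (fun s hs => (hy s hs i).fun_sub (hΘ s hs)) (by simp [hy0, hΘ0]) ht
    rwa [h.init_v, one_mul] at this
  have hsoft : ∀ t, 0 ≤ t → reducedAppraisal A₀ (v t) = softAppraisal A₀ (y t) := fun t ht => by
    rw [funext (hv t ht), reducedAppraisal_exp]
  refine ⟨y, Θ, ⟨hy0, h.init_w, h.mem_w, hy, fun t ht i => ?_⟩, hΘ0, fun t ht => ?_, hv⟩
  · rw [← hsoft t ht]; exact h.deriv_w t ht i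
  · rw [← hsoft t ht]; exact hΘ t ht

end Conversion

/-! ### Irreducible row-stochastic matrices -/

section Irreducible

variable {n : ℕ} {A B : Matrix (Fin n) (Fin n) ℝ}

theorem isIrreducible_of_samePattern (hA : A.IsIrreducible) (h : SamePattern B A)
    (hB : ∀ i j, 0 ≤ B i j) : B.IsIrreducible := by
  refine ⟨hB, ?_⟩
  have : B.toQuiver = A.toQuiver := by
    simp only [Matrix.toQuiver, (h _ _).2]
  rw [this]
  exact hA.connected

theorem forall_of_isIrreducible (hA : A.IsIrreducible) {P : Fin n → Prop}
    (hstep : ∀ i j, P i → 0 < A i j → P j) {m : Fin n} (hm : P m) (j : Fin n) : P j := by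
  let := A.toQuiver
  obtain ⟨q, -⟩ := hA.connected m j
  induction q with
  | nil => exact hm
  | cons _ e ih => exact hstep _ _ ih e.down

/-- The constant vector has eigenvalue one. For any eigenvalue, comparing moduli at a coordinate
where the eigenvector is largest bounds it by the row sum. -/
theorem isDominantEigenvalue_one (hn : 1 ≤ n) (hB : B ∈ Matrix.rowStochastic ℝ (Fin n)) :
    IsDominantEigenvalue B 1 := by
  have hne : Nonempty (Fin n) := ⟨⟨0, hn⟩⟩
  have hspec : ∀ μ : ℂ, μ ∈ spectrum ℂ (B.map Complex.ofReal) ↔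
      ∃ x : Fin n → ℂ, (B.map Complex.ofReal).mulVec x = μ • x ∧ x ≠ 0 := fun μ => by
    rw [← Matrix.spectrum_toLin', ← Module.End.hasEigenvalue_iff_mem_spectrum]
    constructor
    · intro h
      obtain ⟨x, hx⟩ := h.exists_hasEigenvector
      exact ⟨x, by simpa using hx.apply_eq_smul, hx.2⟩
    · rintro ⟨x, hx, hx0⟩
      exact Module.End.hasEigenvalue_of_hasEigenvector
        ⟨Module.End.mem_eigenspace_iff.2 (by simpa using hx), hx0⟩
  refine ⟨(hspec _).2 ⟨fun _ => 1, ?_, ?_⟩, fun μ hμ => ?_⟩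
  · ext i
    have := Matrix.sum_row_of_mem_rowStochastic hB i
    simp only [Matrix.mulVec, dotProduct, Matrix.map_apply, mul_one, Pi.smul_apply, smul_eq_mul]
    exact_mod_cast this
  · intro h
    exact one_ne_zero (congrFun h ⟨0, hn⟩)
  · obtain ⟨x, hx, hx0⟩ := (hspec μ).1 hμ
    obtain ⟨i, hi⟩ := Finite.exists_max fun i => ‖x i‖
    have hpos : 0 < ‖x i‖ := by
      obtain ⟨j, hj⟩ := Function.ne_iff.1 hx0
      exact (norm_pos_iff.2 hj).trans_le (hi j)
    have h1 : ‖μ‖ * ‖x i‖ ≤ 1 * ‖x i‖ := by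
      have e := congrFun hx i
      simp only [Matrix.mulVec, dotProduct, Matrix.map_apply, Pi.smul_apply, smul_eq_mul] at e
      rw [← norm_mul, ← e, ← Matrix.sum_row_of_mem_rowStochastic hB i, Finset.sum_mul]
      refine norm_sum_le_of_le _ fun j _ => ?_
      rw [norm_mul, Complex.norm_real, Real.norm_of_nonneg (hB.1 i j)]
      exact mul_le_mul_of_nonneg_left (hi j) (hB.1 i j)
    exact le_of_mul_le_mul_right h1 hpos

theorem isLeftDominantEigenvector_of_donorFlow (hn : 1 ≤ n) {x : Fin n → ℝ}
    (hirr : B.IsIrreducible) (hB : B ∈ Matrix.rowStochastic ℝ (Fin n)) (hx : x ∈ intSimplex n)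
    (h : ∀ i, donorFlow B x i = 0) : IsLeftDominantEigenvector B x := by
  refine ⟨hirr, hB, hx, 1, isDominantEigenvalue_one hn hB, ?_⟩
  ext i
  have := h i
  simp only [donorFlow] at this
  simp only [Matrix.vecMul, dotProduct, one_smul]
  rw [Finset.sum_congr rfl fun k _ => mul_comm (x k) (B k i)]
  linarith

/-- A positive vector is invariant under at most one of the matrices `softAppraisal A₀ y`. -/
theorem softAppraisal_eq_of_donorFlow {A₀ : Matrix (Fin n) (Fin n) ℝ} (hn : 1 ≤ n)
    (hA : A₀ ∈ Matrix.rowStochastic ℝ (Fin n)) (hirr : A₀.IsIrreducible) (hdiag : ∀ i, 0 < A₀ i i)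
    {w y y' : Fin n → ℝ} (hw : ∀ i, 0 < w i)
    (h : ∀ i, donorFlow (softAppraisal A₀ y) w i = 0)
    (h' : ∀ i, donorFlow (softAppraisal A₀ y') w i = 0) :
    softAppraisal A₀ y = softAppraisal A₀ y' := by
  have hne : Nonempty (Fin n) := ⟨⟨0, hn⟩⟩
  set S := softAppraisal A₀ y with hS
  have hSr := softAppraisal_mem_rowStochastic hA y
  -- The second matrix is `diag(R)⁻¹ S diag(β)` with `R = S β`. A maximum principle for `β` shows
  -- that `β` is constant.
  set β : Fin n → ℝ := fun j => Real.exp (y' j - y j) with hβ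
  have hβ0 : ∀ j, 0 < β j := fun j => Real.exp_pos _
  set R : Fin n → ℝ := fun i => ∑ k, S i k * β k with hR
  have hR0 : ∀ i, 0 < R i := fun i => sum_mul_pos_of_mem_rowStochastic hSr hβ0 i
  have hS' : ∀ i j, softAppraisal A₀ y' i j = S i j * β j / R i := fun i j => by
    have hD := sum_mul_exp_pos hA y i
    have hD' := sum_mul_exp_pos hA y' i
    have e : ∀ j, S i j * β j = A₀ i j * Real.exp (y' j) / ∑ k, A₀ i k * Real.exp (y k) :=
      fun j => by
        simp only [hS, hβ, softAppraisal, Real.exp_sub]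
        field_simp
    simp only [hR, e, ← Finset.sum_div]
    rw [div_div_div_cancel_right₀ hD.ne', softAppraisal]
  obtain ⟨m, hm⟩ := Finite.exists_max β
  have hRM : ∀ i, R i ≤ β m := fun i => by
    calc R i ≤ ∑ k, S i k * β m :=
          Finset.sum_le_sum fun k _ => mul_le_mul_of_nonneg_left (hm k) (hSr.1 i k)
      _ = β m := by rw [← Finset.sum_mul, Matrix.sum_row_of_mem_rowStochastic hSr, one_mul]
  -- Where `β j` is maximal, equality of the two `j`-th column balances forces `R i = β m` for every
  -- `i` with `S i j > 0`. The positive diagonal allows `i = j`; then `β` averages to its maximum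
  -- over row `j`, so it is maximal at all out-neighbours of `j`.
  have hstep : ∀ j k, β j = β m → 0 < A₀ j k → β k = β m := fun j k hj hjk => by
    have hcol : ∑ i, S i j * w i * (β m / R i - 1) = 0 := by
      have h1 := h j
      have h2 := h' j
      simp only [donorFlow, hS'] at h1 h2
      rw [show ∑ i, S i j * w i * (β m / R i - 1)
        = ∑ i, S i j * β j / R i * w i - ∑ i, S i j * w i by
          rw [← Finset.sum_sub_distrib, hj]
          exact Finset.sum_congr rfl fun i _ => by ring]
      linarith
    have hterm := (Finset.sum_eq_zero_iff_of_nonneg fun i _ => mul_nonneg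
      (mul_nonneg (hSr.1 i j) (hw i).le)
      (sub_nonneg.2 ((one_le_div (hR0 i)).2 (hRM i)))).1 hcol j (Finset.mem_univ j)
    have hSjj : 0 < S j j := ((samePattern_softAppraisal hA y j j).2).2 (hdiag j)
    have hRj : R j = β m := by
      have h3 := (mul_eq_zero.1 hterm).resolve_left (mul_pos hSjj (hw j)).ne'
      rw [sub_eq_zero, div_eq_one_iff_eq (hR0 j).ne'] at h3
      exact h3.symm
    have hrow : ∑ k, S j k * (β m - β k) = 0 := by
      simp only [mul_sub, Finset.sum_sub_distrib, ← Finset.sum_mul]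
      rw [Matrix.sum_row_of_mem_rowStochastic hSr, one_mul]
      exact sub_eq_zero.2 hRj.symm
    have hterm' := (Finset.sum_eq_zero_iff_of_nonneg fun k _ => mul_nonneg (hSr.1 j k)
      (sub_nonneg.2 (hm k))).1 hrow k (Finset.mem_univ k)
    have hSjk : 0 < S j k := ((samePattern_softAppraisal hA y j k).2).2 hjk
    exact (sub_eq_zero.1 ((mul_eq_zero.1 hterm').resolve_left hSjk.ne')).symm
  have hall := forall_of_isIrreducible (P := fun j => β j = β m) hirr hstep rfl
  have : y = fun j => y' j - (y' m - y m) := funext fun j => by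
    have := Real.exp_injective (hall j)
    linarith
  rw [hS, this, softAppraisal_sub_const]

end Irreducible

/-! ### The optimal workload -/

section Optimum

variable {n : ℕ} {p : Fin n → ℝ → ℝ}

theorem IsPerformanceFunction.exists_eq {f : ℝ → ℝ} (hf : IsPerformanceFunction f) {c : ℝ}
    (hc : f 1 ≤ c) : ∃ x ∈ Set.Ioc (0 : ℝ) 1, f x = c := by
  have h1 := hf.tendsto_zero.eventually (eventually_ge_atTop c)
  have h2 : ∀ᶠ x : ℝ in 𝓝[>] 0, x ∈ Set.Ioc (0 : ℝ) 1 := Ioc_mem_nhdsGT zero_lt_one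
  obtain ⟨a, ha, ha1⟩ := (h1.and h2).exists
  have hsub : Set.Icc a 1 ⊆ Set.Ioc 0 1 := fun x hx => ⟨ha1.1.trans_le hx.1, hx.2⟩
  obtain ⟨x, hx, hxc⟩ := intermediate_value_Icc' ha1.2 (hf.contDiffOn.continuousOn.mono hsub)
    ⟨hc, ha⟩
  exact ⟨x, hsub hx, hxc⟩

/-- The inverse of a performance function is continuous. -/
theorem IsPerformanceFunction.continuousOn_inverse {f g : ℝ → ℝ} (hf : IsPerformanceFunction f)
    {a : ℝ} (hg : ∀ c ∈ Set.Ici a, g c ∈ Set.Ioc (0 : ℝ) 1 ∧ f (g c) = c) :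
    ContinuousOn g (Set.Ici a) := by
  intro c hc
  obtain ⟨hgc, hfc⟩ := hg c hc
  refine tendsto_order.2 ⟨fun b hb => ?_, fun b hb => ?_⟩
  · rcases le_or_gt b 0 with hb0 | hb0
    · filter_upwards [self_mem_nhdsWithin] with d hd using hb0.trans_lt (hg d hd).1.1
    · have hbm : b ∈ Set.Ioc (0 : ℝ) 1 := ⟨hb0, hb.le.trans hgc.2⟩
      have hlt : c < f b := hfc ▸ hf.strictAntiOn hbm hgc hb
      filter_upwards [self_mem_nhdsWithin, mem_nhdsWithin_of_mem_nhds (Iio_mem_nhds hlt)]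
        with d hd hdb
      refine (hf.strictAntiOn.lt_iff_gt (hg d hd).1 hbm).1 ?_
      rw [(hg d hd).2]
      exact hdb
  · rcases le_or_gt b 1 with hb1 | hb1
    · have hbm : b ∈ Set.Ioc (0 : ℝ) 1 := ⟨hgc.1.trans hb, hb1⟩
      have hlt : f b < c := hfc ▸ hf.strictAntiOn hgc hbm hb
      filter_upwards [self_mem_nhdsWithin, mem_nhdsWithin_of_mem_nhds (Ioi_mem_nhds hlt)]
        with d hd hdb
      refine (hf.strictAntiOn.lt_iff_gt hbm (hg d hd).1).1 ?_
      rw [(hg d hd).2]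
      exact hdb
    · filter_upwards [self_mem_nhdsWithin] with d hd using (hg d hd).1.2.trans_lt hb1

theorem IsOptimalPair.unique (hn : 1 ≤ n) (hp : IsPerformanceFamily p)
    {q q' : ℝ × (Fin n → ℝ)} (h : IsOptimalPair p q) (h' : IsOptimalPair p q') : q = q' := by
  have hne : Nonempty (Fin n) := ⟨⟨0, hn⟩⟩
  have key : ∀ q q' : ℝ × (Fin n → ℝ), IsOptimalPair p q → IsOptimalPair p q' → q.1 ≤ q'.1 :=
    fun q q' h h' => by
      by_contra! hlt
      have hi : ∀ i, q.2 i < q'.2 i := fun i => by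
        have e : p i (q.2 i) = q.1 := congrFun h.2.2 i
        have e' : p i (q'.2 i) = q'.1 := congrFun h'.2.2 i
        refine ((hp.each i).strictAntiOn.lt_iff_gt (intSimplex_mem_Ioc h'.2.1 i)
          (intSimplex_mem_Ioc h.2.1 i)).1 ?_
        rw [e, e']
        exact hlt
      have := Finset.sum_lt_sum_of_nonempty Finset.univ_nonempty fun i _ => hi i
      rw [h.2.1.2, h'.2.1.2] at this
      exact lt_irrefl _ this
  have h1 : q.1 = q'.1 := le_antisymm (key q q' h h') (key q' q h' h)
  refine Prod.ext h1 (funext fun i => ?_)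
  refine (hp.each i).strictAntiOn.injOn (intSimplex_mem_Ioc h.2.1 i)
    (intSimplex_mem_Ioc h'.2.1 i) ?_
  exact (congrFun h.2.2 i).trans (h1.trans (congrFun h'.2.2 i).symm)

/-- The inverses `g i` of the performance functions are continuous, and the intermediate value
theorem finds a level `c` with `∑ g i c = 1`. -/
theorem exists_isOptimalPair (hn : 1 ≤ n) (hp : IsPerformanceFamily p) :
    ∃ q, IsOptimalPair p q := by
  have hne : Nonempty (Fin n) := ⟨⟨0, hn⟩⟩
  have hn0 : (0 : ℝ) < n := by exact_mod_cast hn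
  have hn1 : (1 : ℝ) ≤ n := by exact_mod_cast hn
  -- From level `p k 1` upwards all inverses exist, and there `g k` alone contributes one. At level
  -- `p l (1 / n)` each inverse is at most `1 / n`.
  obtain ⟨k, hk⟩ := Finite.exists_max fun i => p i 1
  obtain ⟨l, hl⟩ := Finite.exists_max fun i => p i (1 / n)
  have hmem : (1 / n : ℝ) ∈ Set.Ioc (0 : ℝ) 1 := ⟨by positivity, by rw [div_le_one hn0]; exact hn1⟩
  have hmem1 : (1 : ℝ) ∈ Set.Ioc (0 : ℝ) 1 := ⟨one_pos, le_rfl⟩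
  choose! g hg hgp using fun (i : Fin n) (c : ℝ) (hc : p k 1 ≤ c) =>
    (hp.each i).exists_eq ((hk i).trans hc)
  have hcont : ContinuousOn (fun c => ∑ i, g i c) (Set.Ici (p k 1)) :=
    continuousOn_finsetSum _ fun i _ => (hp.each i).continuousOn_inverse
      (fun c hc => ⟨hg i c hc, hgp i c hc⟩)
  have hkl : p k 1 ≤ p l (1 / n) :=
    ((hp.each k).strictAntiOn.antitoneOn hmem hmem1 hmem.2).trans (hl k)
  have hlow : 1 ≤ ∑ i, g i (p k 1) := by
    have : g k (p k 1) = 1 := (hp.each k).strictAntiOn.injOn (hg k _ le_rfl) hmem1 (hgp k _ le_rfl)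
    calc (1 : ℝ) = g k (p k 1) := this.symm
      _ ≤ _ := Finset.single_le_sum (f := fun i => g i (p k 1))
        (fun i _ => (hg i _ le_rfl).1.le) (Finset.mem_univ k)
  have hupp : ∑ i, g i (p l (1 / n)) ≤ 1 := by
    calc ∑ i, g i (p l (1 / n)) ≤ ∑ _i : Fin n, (1 / n : ℝ) := Finset.sum_le_sum fun i _ => by
          refine ((hp.each i).strictAntiOn.le_iff_ge hmem (hg i _ hkl)).1 ?_
          rw [hgp i _ hkl]
          exact hl i
      _ = 1 := by simp [hn0.ne']
  obtain ⟨c, hc, hsum⟩ := intermediate_value_Icc' hkl (hcont.mono fun c hc => hc.1) ⟨hupp, hlow⟩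
  have hw : (fun i => g i c) ∈ intSimplex n := ⟨fun i => (hg i c hc.1).1, hsum⟩
  refine ⟨(c, fun i => g i c), ?_, hw, funext fun i => hgp i c hc.1⟩
  have := hp.pos _ hw k
  rwa [hgp k c hc.1] at this

end Optimum

/-! ### Convergence under a one-sided bound -/

theorem exists_tendsto_of_monotoneOn_Ici {f : ℝ → ℝ} (hf : MonotoneOn f (Set.Ici 0)) {C : ℝ}
    (hC : ∀ t, 0 ≤ t → f t ≤ C) : ∃ l, Tendsto f atTop (𝓝 l) := by
  have hmono : Monotone fun t => f (max t 0) := fun s t hst =>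
    hf (Set.mem_Ici.2 (le_max_right _ _)) (Set.mem_Ici.2 (le_max_right _ _))
      (max_le_max_right 0 hst)
  refine ⟨_, (tendsto_atTop_ciSup hmono ⟨C, ?_⟩).congr' ?_⟩
  · rintro _ ⟨t, rfl⟩
    exact hC _ (le_max_right _ _)
  · filter_upwards [eventually_ge_atTop 0] with t ht
    rw [max_eq_left ht]

theorem tendsto_zero_of_eventually_lt {f : ℝ → ℝ}
    (h1 : ∀ δ > 0, ∀ᶠ t in atTop, f t < δ) (h2 : ∀ δ > 0, ∀ᶠ t in atTop, -f t < δ) :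
    Tendsto f atTop (𝓝 0) := by
  refine tendsto_order.2 ⟨fun b hb => ?_, fun b hb => h1 b hb⟩
  filter_upwards [h2 (-b) (neg_pos.2 hb)] with t ht
  linarith

section Gap

variable {f : ℝ → ℝ} {x₀ : ℝ}

theorem IsPerformanceFunction.gap_nonneg (hf : IsPerformanceFunction f)
    (hx₀ : x₀ ∈ Set.Ioc (0 : ℝ) 1) {x : ℝ} (hx : x ∈ Set.Ioc (0 : ℝ) 1) :
    0 ≤ (x₀ - x) * (f x - f x₀) := by
  rcases le_total x x₀ with h | h
  · exact mul_nonneg (sub_nonneg.2 h) (sub_nonneg.2 (hf.strictAntiOn.antitoneOn hx hx₀ h))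
  · exact mul_nonneg_of_nonpos_of_nonpos (sub_nonpos.2 h)
      (sub_nonpos.2 (hf.strictAntiOn.antitoneOn hx₀ hx h))

theorem IsPerformanceFunction.exists_gap_right (hf : IsPerformanceFunction f)
    (hx₀ : x₀ ∈ Set.Ioc (0 : ℝ) 1) {δ : ℝ} (hδ : 0 < δ) :
    ∃ m > 0, ∀ x ∈ Set.Ioc (0 : ℝ) 1, δ ≤ x - x₀ → m ≤ (x₀ - x) * (f x - f x₀) := by
  rcases le_or_gt (x₀ + δ) 1 with h | h
  · have hm : x₀ + δ ∈ Set.Ioc (0 : ℝ) 1 := ⟨by linarith [hx₀.1], h⟩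
    have hlt := hf.strictAntiOn hx₀ hm (by linarith)
    refine ⟨δ * (f x₀ - f (x₀ + δ)), mul_pos hδ (by linarith), fun x hx hδx => ?_⟩
    have := hf.strictAntiOn.antitoneOn hm hx (by linarith)
    nlinarith
  -- No point of the domain lies so far to the right; the constant is arbitrary.
  · exact ⟨1, one_pos, fun x hx hδx => by linarith [hx.2]⟩

theorem IsPerformanceFunction.exists_gap_left (hf : IsPerformanceFunction f)
    (hx₀ : x₀ ∈ Set.Ioc (0 : ℝ) 1) {δ : ℝ} (hδ : 0 < δ) :
    ∃ m > 0, ∀ x ∈ Set.Ioc (0 : ℝ) 1, δ ≤ x₀ - x → m ≤ (x₀ - x) * (f x - f x₀) := by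
  rcases lt_or_ge 0 (x₀ - δ) with h | h
  · have hm : x₀ - δ ∈ Set.Ioc (0 : ℝ) 1 := ⟨h, by linarith [hx₀.2]⟩
    have hlt := hf.strictAntiOn hm hx₀ (by linarith)
    refine ⟨δ * (f (x₀ - δ) - f x₀), mul_pos hδ (by linarith), fun x hx hδx => ?_⟩
    have := hf.strictAntiOn.antitoneOn hx hm (by linarith)
    nlinarith
  · exact ⟨1, one_pos, fun x hx hδx => by linarith [hx.1]⟩

end Gap

section Convergence

variable {n : ℕ} {p : Fin n → ℝ → ℝ} {A₀ : Matrix (Fin n) (Fin n) ℝ} {w₀ : Fin n → ℝ}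
  {y w : ℝ → Fin n → ℝ} {pstar : ℝ} {wopt : Fin n → ℝ} {z : ℝ → ℝ}

/-- As `wopt - x` has zero sum, the common value `pstar` can be subtracted from every performance,
which makes each term a monotonicity gap. -/
theorem IsOptimalPair.sum_sub_mul (hq : IsOptimalPair p (pstar, wopt)) {x : Fin n → ℝ}
    (hx : x ∈ intSimplex n) :
    ∑ i, wopt i * p i (x i) - ∑ i, p i (x i) * x i
      = ∑ i, (wopt i - x i) * (p i (x i) - p i (wopt i)) := by
  have hpi : ∀ i, p i (wopt i) = pstar := fun i => congrFun hq.2.2 i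
  have h1 : ∑ i, (wopt i - x i) * pstar = 0 := by
    rw [← Finset.sum_mul, Finset.sum_sub_distrib, hq.2.1.2, hx.2, sub_self, zero_mul]
  have h2 : ∑ i, (wopt i - x i) * (p i (x i) - p i (wopt i))
      = ∑ i, wopt i * p i (x i) - ∑ i, p i (x i) * x i - ∑ i, (wopt i - x i) * pstar := by
    rw [← Finset.sum_sub_distrib, ← Finset.sum_sub_distrib]
    exact Finset.sum_congr rfl fun i _ => by rw [hpi i]; ring
  rw [h2, h1, sub_zero]

theorem IsCumulativeTrajectory.hasDerivWithinAt_potential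
    (hq : IsOptimalPair p (pstar, wopt)) (h : IsCumulativeTrajectory p A₀ w₀ y w)
    (hz : ∀ t, 0 ≤ t → HasDerivWithinAt z (∑ i, p i (w t i) * w t i) (Set.Ici 0) t)
    {t : ℝ} (ht : 0 ≤ t) :
    HasDerivWithinAt (fun t => ∑ i, wopt i * y t i - z t)
      (∑ i, (wopt i - w t i) * (p i (w t i) - p i (wopt i))) (Set.Ici 0) t := by
  rw [← hq.sum_sub_mul (h.mem_w t ht)]
  exact (HasDerivWithinAt.fun_sum fun i _ => (h.deriv_y t ht i).const_mul _).fun_sub (hz t ht)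

theorem IsCumulativeTrajectory.abs_w_sub_le (hA : A₀ ∈ Matrix.rowStochastic ℝ (Fin n))
    (h : IsCumulativeTrajectory p A₀ w₀ y w) (i : Fin n) {s t : ℝ} (hs : 0 ≤ s) (ht : 0 ≤ t) :
    |w t i - w s i| ≤ (1 + n) * |t - s| :=
  abs_sub_le_of_hasDerivWithinAt (f := fun t => w t i) (fun r hr => h.deriv_w r hr i)
    (fun r hr => abs_donorFlow_le (softAppraisal_mem_rowStochastic hA _)
      (fun k => ((h.mem_w r hr).1 k).le) (intSimplex_le_one (h.mem_w r hr)) i) hs ht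

/-- The potential is nondecreasing and bounded, and its derivative dominates each single gap, which
is bounded below whenever `w i` is `δ` away from `wopt i` on either side. Since `w` is Lipschitz,
the Barbalat lemma applies. -/
theorem IsCumulativeTrajectory.tendsto_w (hp : IsPerformanceFamily p)
    (hA : A₀ ∈ Matrix.rowStochastic ℝ (Fin n)) (hq : IsOptimalPair p (pstar, wopt))
    (h : IsCumulativeTrajectory p A₀ w₀ y w)
    (hz : ∀ t, 0 ≤ t → HasDerivWithinAt z (∑ i, p i (w t i) * w t i) (Set.Ici 0) t)
    {C : ℝ} (hC : ∀ t, 0 ≤ t → ∑ i, wopt i * y t i - z t ≤ C) :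
    Tendsto w atTop (𝓝 wopt) := by
  have hopt := fun i => intSimplex_mem_Ioc hq.2.1 i
  have hdom := fun t ht i => intSimplex_mem_Ioc (h.mem_w t ht) i
  have hU := fun t ht => h.hasDerivWithinAt_potential hq hz (t := t) ht
  have hnn : ∀ t, 0 ≤ t → ∀ i, 0 ≤ (wopt i - w t i) * (p i (w t i) - p i (wopt i)) :=
    fun t ht i => (hp.each i).gap_nonneg (hopt i) (hdom t ht i)
  obtain ⟨l, hl⟩ := exists_tendsto_of_monotoneOn_Ici
    (monotoneOn_Ici_of_hasDerivWithinAt hU fun t ht => Finset.sum_nonneg fun i _ => hnn t ht i) hC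
  have hle : ∀ t, 0 ≤ t → ∀ i, (wopt i - w t i) * (p i (w t i) - p i (wopt i)) ≤
      ∑ i, (wopt i - w t i) * (p i (w t i) - p i (wopt i)) := fun t ht i =>
    Finset.single_le_sum (f := fun i => (wopt i - w t i) * (p i (w t i) - p i (wopt i)))
      (fun j _ => hnn t ht j) (Finset.mem_univ i)
  have hK : (0 : ℝ) ≤ 1 + n := by positivity
  refine tendsto_pi_nhds.2 fun i => ?_
  have h0 : Tendsto (fun t => w t i - wopt i) atTop (𝓝 0) := by
    refine tendsto_zero_of_eventually_lt (fun δ hδ => ?_) (fun δ hδ => ?_)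
    · refine eventually_lt_of_hasDerivWithinAt hK hU hl (fun s t hs ht => ?_) (fun δ hδ => ?_) hδ
      · simpa using h.abs_w_sub_le hA i hs ht
      · obtain ⟨m, hm, hm'⟩ := (hp.each i).exists_gap_right (hopt i) hδ
        exact ⟨m, hm, fun t ht hδt => (hm' _ (hdom t ht i) hδt).trans (hle t ht i)⟩
    · refine eventually_lt_of_hasDerivWithinAt hK hU hl (fun s t hs ht => ?_) (fun δ hδ => ?_) hδ
      · rw [show -(w t i - wopt i) - -(w s i - wopt i) = -(w t i - w s i) by ring, abs_neg]
        exact h.abs_w_sub_le hA i hs ht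
      · obtain ⟨m, hm, hm'⟩ := (hp.each i).exists_gap_left (hopt i) hδ
        exact ⟨m, hm, fun t ht hδt =>
          (hm' _ (hdom t ht i) (by linarith)).trans (hle t ht i)⟩
  simpa using h0.add_const (wopt i)

/-- Once `w` is near `wopt`, the performances are bounded, so `y` and with it `w'` are Lipschitz;
Barbalat is then applied to the convergent `w i` itself. -/
theorem IsCumulativeTrajectory.tendsto_donorFlow (hp : IsPerformanceFamily p)
    (hA : A₀ ∈ Matrix.rowStochastic ℝ (Fin n)) (hopt : wopt ∈ intSimplex n)
    (h : IsCumulativeTrajectory p A₀ w₀ y w) (hw : Tendsto w atTop (𝓝 wopt)) (i : Fin n) :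
    Tendsto (fun t => donorFlow (softAppraisal A₀ (y t)) (w t) i) atTop (𝓝 0) := by
  have hpt : ∀ j, ∀ᶠ t in atTop, p j (w t j) < p j (wopt j) + 1 := fun j => by
    have hc := (hp.each j).contDiffOn.continuousOn (wopt j) (intSimplex_mem_Ioc hopt j)
    have hwj : Tendsto (fun t => w t j) atTop (𝓝[Set.Ioc 0 1] wopt j) := by
      refine tendsto_nhdsWithin_iff.2 ⟨tendsto_pi_nhds.1 hw j, ?_⟩
      filter_upwards [eventually_ge_atTop 0] with t ht using intSimplex_mem_Ioc (h.mem_w t ht) j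
    exact (hc.tendsto.comp hwj).eventually (gt_mem_nhds (by linarith))
  obtain ⟨T, hT⟩ := eventually_atTop.1 ((eventually_all.2 hpt).and (eventually_ge_atTop 0))
  have hT0 : 0 ≤ T := (hT T le_rfl).2
  set M : ℝ := ∑ j, (p j (wopt j) + 1) with hM
  have hpM : ∀ t, T ≤ t → ∀ j, |p j (w t j)| ≤ M := fun t ht j => by
    have h0 : 0 ≤ p j (w t j) :=
      (hp.each j).nonneg _ (intSimplex_mem_Ioc (h.mem_w t (hT0.trans ht)) j)
    rw [abs_of_nonneg h0]
    refine ((hT t ht).1 j).le.trans ?_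
    refine Finset.single_le_sum (f := fun j => p j (wopt j) + 1) (fun k _ => ?_)
      (Finset.mem_univ j)
    have := (hp.each k).nonneg _ (intSimplex_mem_Ioc hopt k)
    linarith
  have hM0 : 0 ≤ M := (abs_nonneg _).trans (hpM T le_rfl i)
  have hyL : ∀ s t, T ≤ s → T ≤ t → ∀ j, |y t j - y s j| ≤ M * |t - s| := fun s t hs ht j =>
    abs_sub_le_of_hasDerivWithinAt (f := fun t => y t j)
      (fun r hr => (h.deriv_y r (hT0.trans hr) j).mono (Set.Ici_subset_Ici.2 hT0))
      (fun r hr => hpM r hr j) hs ht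
  have hn0 : (0 : ℝ) ≤ n := n.cast_nonneg
  have hgL : ∀ s t, T ≤ s → T ≤ t →
      |donorFlow (softAppraisal A₀ (y t)) (w t) i - donorFlow (softAppraisal A₀ (y s)) (w s) i| ≤
        ((1 + n) + n * (2 * M + (1 + n))) * |t - s| := fun s t hs ht => by
    have hmt := h.mem_w t (hT0.trans ht)
    refine (abs_donorFlow_sub_le (softAppraisal_mem_rowStochastic hA _) (fun k => (hmt.1 k).le)
      (intSimplex_le_one hmt) (abs_softAppraisal_sub_le hA (hyL s t hs ht))
      (fun k => h.abs_w_sub_le hA k (hT0.trans hs) (hT0.trans ht)) i).trans (le_of_eq ?_)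
    ring
  have hd : ∀ t, T ≤ t → HasDerivWithinAt (fun s => w s i)
      (donorFlow (softAppraisal A₀ (y t)) (w t) i) (Set.Ici T) t := fun t ht =>
    (h.deriv_w t (hT0.trans ht) i).mono (Set.Ici_subset_Ici.2 hT0)
  have hK : 0 ≤ (1 + n) + n * (2 * M + (1 + n)) := by positivity
  refine tendsto_zero_of_eventually_lt (fun δ hδ => ?_) (fun δ hδ => ?_)
  · exact eventually_lt_of_hasDerivWithinAt hK hd (tendsto_pi_nhds.1 hw i) hgL
      (fun δ hδ => ⟨δ, hδ, fun t _ h => h⟩) hδ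
  · refine eventually_lt_of_hasDerivWithinAt hK (fun t ht => (hd t ht).fun_neg)
      (tendsto_pi_nhds.1 hw i).neg (fun s t hs ht => ?_)
      (fun δ hδ => ⟨δ, hδ, fun t _ h => h⟩) hδ
    rw [neg_sub_neg, abs_sub_comm]
    exact hgL s t hs ht

theorem IsCumulativeTrajectory.tendsto_of_bounded (hn : 1 ≤ n) (hp : IsPerformanceFamily p)
    (hA : A₀ ∈ Matrix.rowStochastic ℝ (Fin n)) (hirr : A₀.IsIrreducible) (hdiag : ∀ i, 0 < A₀ i i)
    (hq : IsOptimalPair p (pstar, wopt)) (h : IsCumulativeTrajectory p A₀ w₀ y w)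
    (hz0 : z 0 = 0)
    (hz : ∀ t, 0 ≤ t → HasDerivWithinAt z (∑ i, p i (w t i) * w t i) (Set.Ici 0) t)
    {C : ℝ} (hC : ∀ t, 0 ≤ t → ∀ i, y t i - z t ≤ C) :
    ∃ Astar, Tendsto (fun t => (softAppraisal A₀ (y t), w t)) atTop (𝓝 (Astar, wopt)) ∧
      Astar ∈ Matrix.rowStochastic ℝ (Fin n) ∧ SamePattern Astar A₀ ∧
      IsLeftDominantEigenvector Astar wopt := by
  have hopt := hq.2.1
  have hUeq : ∀ t (c : ℝ), ∑ i, wopt i * (c - (y t i - z t))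
      = c - (∑ i, wopt i * y t i - z t) := fun t c => by
    have : ∀ i, wopt i * (c - (y t i - z t)) = wopt i * (c + z t) - wopt i * y t i :=
      fun i => by ring
    simp only [this, Finset.sum_sub_distrib, ← Finset.sum_mul]
    rw [hopt.2]
    ring
  have hUle : ∀ t, 0 ≤ t → ∑ i, wopt i * y t i - z t ≤ C := fun t ht => by
    have h1 : 0 ≤ ∑ i, wopt i * (C - (y t i - z t)) := Finset.sum_nonneg fun i _ =>
      mul_nonneg (hopt.1 i).le (sub_nonneg.2 (hC t ht i))
    rw [hUeq] at h1
    linarith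
  have hU0 : ∀ t, 0 ≤ t → 0 ≤ ∑ i, wopt i * y t i - z t := fun t ht => by
    have := monotoneOn_Ici_of_hasDerivWithinAt
      (fun t ht => h.hasDerivWithinAt_potential hq hz ht)
      (fun t ht => Finset.sum_nonneg fun i _ => (hp.each i).gap_nonneg
        (intSimplex_mem_Ioc hopt i) (intSimplex_mem_Ioc (h.mem_w t ht) i))
      Set.self_mem_Ici ht ht
    simpa [h.init_y, hz0] using this
  have hw := h.tendsto_w hp hA hq hz hUle
  have hflow := h.tendsto_donorFlow hp hA hopt hw
  have hcomp : IsCompact (Set.pi Set.univ fun i => Set.Icc (C - C / wopt i) C) :=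
    isCompact_univ_pi fun i => isCompact_Icc
  -- The lower edge comes from `wopt i * (C - (y i - z)) ≤ C - U ≤ C`, using `U ≥ 0`.
  have hbox : ∀ᶠ t in atTop, (fun i => y t i - z t) ∈
      Set.pi Set.univ fun i => Set.Icc (C - C / wopt i) C := by
    filter_upwards [eventually_ge_atTop 0] with t ht i _
    refine ⟨?_, hC t ht i⟩
    have h1 := Finset.single_le_sum (f := fun i => wopt i * (C - (y t i - z t)))
      (fun i _ => mul_nonneg (hopt.1 i).le (sub_nonneg.2 (hC t ht i))) (Finset.mem_univ i)
    rw [hUeq] at h1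
    have h2 : C - (y t i - z t) ≤ C / wopt i := by
      rw [le_div_iff₀ (hopt.1 i), mul_comm]
      linarith [hU0 t ht]
    linarith
  -- Along each ultrafilter `y - z` converges by compactness, and `w' → 0` passes to the limit.
  -- Distinct ultrafilters may give distinct `ybar`, but the matrix is the same.
  have hlim : ∀ 𝒰 : Ultrafilter ℝ, (𝒰 : Filter ℝ) ≤ atTop → ∃ ybar,
      Tendsto (fun t => softAppraisal A₀ (y t)) 𝒰 (𝓝 (softAppraisal A₀ ybar)) ∧
      ∀ i, donorFlow (softAppraisal A₀ ybar) wopt i = 0 := fun 𝒰 h𝒰 => by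
    obtain ⟨ybar, -, hybar⟩ := isCompact_iff_ultrafilter_le_nhds.1 hcomp
      (𝒰.map fun t i => y t i - z t) (le_principal_iff.2 (h𝒰 hbox))
    have hT : Tendsto (fun t i => y t i - z t) 𝒰 (𝓝 ybar) := hybar
    have hS : ∀ i j, Tendsto (fun t => softAppraisal A₀ (y t) i j) 𝒰
        (𝓝 (softAppraisal A₀ ybar i j)) := fun i j => by
      have := ((continuous_softAppraisal hA i j).tendsto ybar).comp hT
      refine this.congr fun t => ?_
      simp only [Function.comp, softAppraisal_sub_const]
    refine ⟨ybar, tendsto_pi_nhds.2 fun i => tendsto_pi_nhds.2 fun j => hS i j, fun i => ?_⟩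
    have hw' : ∀ k, Tendsto (fun t => w t k) 𝒰 (𝓝 (wopt k)) := fun k =>
      (tendsto_pi_nhds.1 hw k).mono_left h𝒰
    refine tendsto_nhds_unique ?_ ((hflow i).mono_left h𝒰)
    simp only [donorFlow]
    exact (hw' i).neg.add (tendsto_finsetSum _ fun k _ => (hS k i).mul (hw' k))
  obtain ⟨ybar, -, hybar⟩ := hlim (Ultrafilter.of atTop) (Ultrafilter.of_le atTop)
  have hstoch := softAppraisal_mem_rowStochastic hA ybar
  have hpat := samePattern_softAppraisal hA ybar
  refine ⟨softAppraisal A₀ ybar, Tendsto.prodMk_nhds ?_ hw, hstoch, hpat,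
    isLeftDominantEigenvector_of_donorFlow hn (isIrreducible_of_samePattern hirr hpat hstoch.1)
      hstoch hopt hybar⟩
  refine (tendsto_iff_ultrafilter _ _ _).2 fun 𝒰 h𝒰 => ?_
  obtain ⟨y', hy', hflow'⟩ := hlim 𝒰 h𝒰
  rwa [softAppraisal_eq_of_donorFlow hn hA hirr hdiag hopt.1 hybar hflow']

end Convergence

/-! ### Boundedness criteria -/

/-- An integrable performance function has an antiderivative that is bounded on `(0,1]`. -/
theorem IsPerformanceFunction.exists_bounded_antiderivative {f : ℝ → ℝ}
    (hf : IsPerformanceFunction f) :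
    ∃ (F : ℝ → ℝ) (B : ℝ), (∀ x ∈ Set.Ioc (0 : ℝ) 1, |F x| ≤ B) ∧
      ∀ x ∈ Set.Ioc (0 : ℝ) 1, HasDerivAt F (f (min x 1)) x := by
  -- Extending `f` constantly beyond one makes the antiderivative two-sidedly differentiable at the
  -- endpoint `1`.
  set g : ℝ → ℝ := fun x => f (min x 1) with hg
  have hgf : Set.EqOn f g (Set.Ioc 0 1) := fun x hx => by simp [hg, min_eq_left hx.2]
  have hg_int : MeasureTheory.IntegrableOn g (Set.Ioc 0 1) :=
    hf.integrableOn.congr_fun hgf measurableSet_Ioc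
  have hcont : ContinuousOn g (Set.Ioi 0) :=
    hf.contDiffOn.continuousOn.comp (by fun_prop) fun x hx =>
      ⟨lt_min hx zero_lt_one, min_le_right _ _⟩
  have hsub : ∀ x ∈ Set.Ioc (0 : ℝ) 1, Set.Ioc 0 x ⊆ Set.Ioc 0 1 := fun x hx =>
    Set.Ioc_subset_Ioc_right hx.2
  refine ⟨fun x => ∫ s in (0 : ℝ)..x, g s, ∫ s in Set.Ioc (0 : ℝ) 1, ‖g s‖, fun x hx => ?_,
    fun x hx => ?_⟩
  · change ‖∫ s in (0 : ℝ)..x, g s‖ ≤ _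
    rw [intervalIntegral.integral_of_le hx.1.le]
    refine (MeasureTheory.norm_integral_le_integral_norm _).trans ?_
    exact MeasureTheory.setIntegral_mono_set hg_int.norm
      (Eventually.of_forall fun s => norm_nonneg _) (hsub x hx).eventuallyLE
  · refine intervalIntegral.integral_hasDerivAt_right ?_ ?_ ?_
    · exact (intervalIntegrable_iff_integrableOn_Ioc_of_le hx.1.le).2 (hg_int.mono_set (hsub x hx))
    · exact hcont.stronglyMeasurableAtFilter isOpen_Ioi x hx.1
    · exact hcont.continuousAt (Ioi_mem_nhds hx.1)

section Bounds

variable {n : ℕ} {p : Fin n → ℝ → ℝ} {A₀ : Matrix (Fin n) (Fin n) ℝ} {w₀ : Fin n → ℝ}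
  {y w : ℝ → Fin n → ℝ} {pstar : ℝ} {wopt : Fin n → ℝ} {z Θ : ℝ → ℝ}

theorem IsCumulativeTrajectory.exists_antiderivative_workload (hp : IsPerformanceFamily p)
    (h : IsCumulativeTrajectory p A₀ w₀ y w) :
    ∃ z : ℝ → ℝ, z 0 = 0 ∧
      ∀ t, 0 ≤ t → HasDerivWithinAt z (∑ i, p i (w t i) * w t i) (Set.Ici 0) t :=
  exists_antiderivative_Ici <| continuousOn_finsetSum _ fun i _ =>
    (h.continuousOn_performance hp i).mul (h.continuousOn_w i)

/-- The two normalisations of the cumulative performances differ by a bounded quantity, the total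
performance of the team. -/
theorem IsCumulativeTrajectory.exists_abs_sub_le (hp : IsPerformanceFamily p)
    (h : IsCumulativeTrajectory p A₀ w₀ y w) (hz0 : z 0 = 0)
    (hz : ∀ t, 0 ≤ t → HasDerivWithinAt z (∑ i, p i (w t i) * w t i) (Set.Ici 0) t)
    (hΘ0 : Θ 0 = 0)
    (hΘ : ∀ t, 0 ≤ t → HasDerivWithinAt Θ
      (w t ⬝ᵥ (softAppraisal A₀ (y t)).mulVec (perf p (w t))) (Set.Ici 0) t) :
    ∃ B, ∀ t, 0 ≤ t → |Θ t - z t| ≤ B := by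
  choose F B hB hF using fun i => (hp.each i).exists_bounded_antiderivative
  have hdom := fun t ht i => intSimplex_mem_Ioc (h.mem_w t ht) i
  -- Pairing `p(w)` with `w' = -w + Aᵀ w` yields exactly `Θ' - z'`.
  have hd : ∀ t, 0 ≤ t → HasDerivWithinAt (fun t => ∑ i, F i (w t i) - (Θ t - z t)) 0
      (Set.Ici 0) t := fun t ht => by
    have h1 := HasDerivWithinAt.fun_sum (u := Finset.univ) fun i _ =>
      (hF i _ (hdom t ht i)).comp_hasDerivWithinAt t (h.deriv_w t ht i)
    refine (h1.fun_sub ((hΘ t ht).fun_sub (hz t ht))).congr_deriv ?_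
    have e : ∑ i, p i (w t i) * ∑ k, softAppraisal A₀ (y t) k i * w t k
        = w t ⬝ᵥ (softAppraisal A₀ (y t)).mulVec (perf p (w t)) := by
      simp only [dotProduct, Matrix.mulVec, perf, Finset.mul_sum]
      rw [Finset.sum_comm]
      exact Finset.sum_congr rfl fun k _ => Finset.sum_congr rfl fun i _ => by ring
    rw [← e]
    simp only [donorFlow, min_eq_left (hdom t ht _).2, mul_add, Finset.sum_add_distrib, mul_neg,
      Finset.sum_neg_distrib]
    ring
  have hs : ∀ t, 0 ≤ t → |∑ i, F i (w t i)| ≤ ∑ i, B i := fun t ht =>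
    (Finset.abs_sum_le_sum_abs _ _).trans (Finset.sum_le_sum fun i _ => hB i _ (hdom t ht i))
  refine ⟨2 * ∑ i, B i, fun t ht => ?_⟩
  have h1 := eq_of_hasDerivWithinAt_zero_Ici hd ht
  have h2 := abs_le.1 (hs t ht)
  have h3 := abs_le.1 (hs 0 le_rfl)
  simp only [hΘ0, hz0] at h1
  rw [abs_le]
  constructor <;> linarith

theorem IsCumulativeTrajectory.tendsto_of_reduced_bounded (hn : 1 ≤ n)
    (hp : IsPerformanceFamily p) (hA : A₀ ∈ Matrix.rowStochastic ℝ (Fin n))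
    (hirr : A₀.IsIrreducible) (hdiag : ∀ i, 0 < A₀ i i)
    (hq : IsOptimalPair p (pstar, wopt)) (h : IsCumulativeTrajectory p A₀ w₀ y w)
    (hΘ0 : Θ 0 = 0)
    (hΘ : ∀ t, 0 ≤ t → HasDerivWithinAt Θ
      (w t ⬝ᵥ (softAppraisal A₀ (y t)).mulVec (perf p (w t))) (Set.Ici 0) t)
    {C : ℝ} (hC : ∀ t, 0 ≤ t → ∀ i, y t i - Θ t ≤ C) :
    ∃ Astar, Tendsto (fun t => (softAppraisal A₀ (y t), w t)) atTop (𝓝 (Astar, wopt)) ∧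
      Astar ∈ Matrix.rowStochastic ℝ (Fin n) ∧ SamePattern Astar A₀ ∧
      IsLeftDominantEigenvector Astar wopt := by
  obtain ⟨z, hz0, hz⟩ := h.exists_antiderivative_workload hp
  obtain ⟨B, hB⟩ := h.exists_abs_sub_le hp hz0 hz hΘ0 hΘ
  refine h.tendsto_of_bounded hn hp hA hirr hdiag hq hz0 hz (C := C + B) fun t ht i => ?_
  linarith [hC t ht i, (abs_le.1 (hB t ht)).2]

/-! ### Log-sum-exp of the cumulative performances -/

theorem hasDerivWithinAt_log_sum_exp (hA : A₀ ∈ Matrix.rowStochastic ℝ (Fin n))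
    {q : Fin n → ℝ} {s : Set ℝ} {t : ℝ}
    (hy : ∀ i, HasDerivWithinAt (fun s => y s i) (q i) s t) (i : Fin n) :
    HasDerivWithinAt (fun s => Real.log (∑ k, A₀ i k * Real.exp (y s k)))
      (∑ k, softAppraisal A₀ (y t) i k * q k) s t := by
  refine ((HasDerivWithinAt.fun_sum (u := Finset.univ) fun k _ =>
    (hy k).exp.const_mul (A₀ i k)).log (sum_mul_exp_pos hA (y t) i).ne').congr_deriv ?_
  rw [Finset.sum_div]
  exact Finset.sum_congr rfl fun k _ => by rw [softAppraisal]; ring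

theorem log_add_le_log_sum_exp (hA : A₀ ∈ Matrix.rowStochastic ℝ (Fin n)) {i j : Fin n}
    (hij : 0 < A₀ i j) (x : Fin n → ℝ) :
    Real.log (A₀ i j) + x j ≤ Real.log (∑ k, A₀ i k * Real.exp (x k)) := by
  have : Real.log (A₀ i j) + x j = Real.log (A₀ i j * Real.exp (x j)) := by
    rw [Real.log_mul hij.ne' (Real.exp_pos _).ne', Real.log_exp]
  rw [this]
  exact Real.log_le_log (mul_pos hij (Real.exp_pos _))
    (Finset.single_le_sum (f := fun k => A₀ i k * Real.exp (x k))
      (fun k _ => mul_nonneg (hA.1 i k) (Real.exp_pos _).le) (Finset.mem_univ j))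

/-! ### Rank-one initial appraisals -/

/-- With equal rows `wᵀ A p(w)` does not depend on `w` as a weight, so `Θ` is the log-sum-exp of `y`
and `y i - Θ ≤ -log (a i)`. -/
theorem IsCumulativeTrajectory.tendsto_of_rank_one (hn : 1 ≤ n) (hp : IsPerformanceFamily p)
    (hA : A₀ ∈ Matrix.rowStochastic ℝ (Fin n)) (hirr : A₀.IsIrreducible) (hdiag : ∀ i, 0 < A₀ i i)
    (hq : IsOptimalPair p (pstar, wopt)) (h : IsCumulativeTrajectory p A₀ w₀ y w)
    {a : Fin n → ℝ} (ha : a ∈ intSimplex n) (hAa : A₀ = Matrix.vecMulVec (fun _ => 1) a) :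
    Tendsto (fun t => (softAppraisal A₀ (y t), w t)) atTop
      (𝓝 (Matrix.vecMulVec (fun _ => 1) wopt, wopt)) := by
  have hAij : ∀ i j, A₀ i j = a j := fun i j => by simp [hAa, Matrix.vecMulVec_apply]
  have hrow : ∀ x i k, softAppraisal A₀ x i = softAppraisal A₀ x k := fun x i k => by
    ext j
    simp only [softAppraisal, hAij]
  obtain ⟨Θ, hΘ0, hΘ⟩ := h.exists_antiderivative hp hA
  let i₀ : Fin n := ⟨0, hn⟩
  have hL : ∀ t, 0 ≤ t →
      Real.log (∑ k, A₀ i₀ k * Real.exp (y t k)) = Θ t := fun t ht => by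
    have hd : ∀ s, 0 ≤ s → HasDerivWithinAt
        (fun s => Real.log (∑ k, A₀ i₀ k * Real.exp (y s k)) - Θ s) 0 (Set.Ici 0) s :=
      fun s hs => by
        refine ((hasDerivWithinAt_log_sum_exp hA (h.deriv_y s hs) i₀).fun_sub
          (hΘ s hs)).congr_deriv ?_
        simp only [dotProduct, Matrix.mulVec, perf, fun i => hrow (y s) i i₀]
        rw [← Finset.sum_mul, (h.mem_w s hs).2, one_mul, sub_self]
    have := eq_of_hasDerivWithinAt_zero_Ici hd ht
    rw [h.init_y, hΘ0] at this
    simp only [Real.exp_zero, mul_one, Matrix.sum_row_of_mem_rowStochastic hA, Real.log_one,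
      sub_zero] at this
    linarith
  obtain ⟨Astar, hlim, -⟩ := h.tendsto_of_reduced_bounded hn hp hA hirr hdiag hq hΘ0 hΘ
    (C := ∑ i, -Real.log (a i)) fun t ht i => by
      have h1 := log_add_le_log_sum_exp hA (hAij i₀ i ▸ ha.1 i) (y t)
      rw [hL t ht, hAij] at h1
      have h2 := Finset.single_le_sum (f := fun i => -Real.log (a i)) (fun k _ => neg_nonneg.2
        (Real.log_nonpos (ha.1 k).le (intSimplex_le_one ha k))) (Finset.mem_univ i)
      linarith
  have hw : Tendsto w atTop (𝓝 wopt) := (Prod.tendsto_iff _ _).1 hlim |>.2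
  refine Tendsto.prodMk_nhds (tendsto_pi_nhds.2 fun i => tendsto_pi_nhds.2 fun j => ?_) hw
  -- For equal rows `Aᵀ w` is the common row, so that row is `w' + w` and tends to `wopt`.
  have hj := (h.tendsto_donorFlow hp hA hq.2.1 hw j).add (tendsto_pi_nhds.1 hw j)
  simp only [Matrix.vecMulVec_apply, one_mul]
  rw [zero_add] at hj
  refine hj.congr' ?_
  filter_upwards [eventually_ge_atTop 0] with t ht
  simp only [donorFlow, fun k => hrow (y t) k i]
  rw [← Finset.mul_sum, (h.mem_w t ht).2]
  ring

/-! ### Positive initial appraisals and two individuals -/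

/-- The energy weighs the log-normalisers of the rows against `y`; subtracting `Θ - z` replaces the
weights `wopt` by `wopt - w` in the derivative. -/
theorem IsCumulativeTrajectory.hasDerivWithinAt_energy
    (hA : A₀ ∈ Matrix.rowStochastic ℝ (Fin n)) (h : IsCumulativeTrajectory p A₀ w₀ y w)
    (hz : ∀ t, 0 ≤ t → HasDerivWithinAt z (∑ i, p i (w t i) * w t i) (Set.Ici 0) t)
    (hΘ : ∀ t, 0 ≤ t → HasDerivWithinAt Θ
      (w t ⬝ᵥ (softAppraisal A₀ (y t)).mulVec (perf p (w t))) (Set.Ici 0) t)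
    {t : ℝ} (ht : 0 ≤ t) :
    HasDerivWithinAt (fun t => ∑ i, wopt i * Real.log (∑ k, A₀ i k * Real.exp (y t k))
        - ∑ i, wopt i * y t i - (Θ t - z t))
      (∑ i, (wopt i - w t i) * (∑ k, softAppraisal A₀ (y t) i k * p k (w t k) - p i (w t i)))
      (Set.Ici 0) t := by
  refine (((HasDerivWithinAt.fun_sum (u := Finset.univ) fun i _ =>
    (hasDerivWithinAt_log_sum_exp hA (h.deriv_y t ht) i).const_mul (wopt i)).fun_sub
    (HasDerivWithinAt.fun_sum (u := Finset.univ) fun i _ =>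
      (h.deriv_y t ht i).const_mul (wopt i))).fun_sub
    ((hΘ t ht).fun_sub (hz t ht))).congr_deriv ?_
  simp only [dotProduct, Matrix.mulVec, perf]
  rw [← Finset.sum_sub_distrib, ← Finset.sum_sub_distrib, ← Finset.sum_sub_distrib]
  exact Finset.sum_congr rfl fun i _ => by ring

theorem exists_le_log_sum_exp_sub (hn : 1 ≤ n) (hA : A₀ ∈ Matrix.rowStochastic ℝ (Fin n))
    (hpos : ∀ i j, 0 < A₀ i j) (hopt : wopt ∈ intSimplex n) :
    ∃ c : ℝ, ∀ x : Fin n → ℝ, ∀ j, c + x j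
      ≤ ∑ i, wopt i * Real.log (∑ k, A₀ i k * Real.exp (x k)) := by
  have hne : Nonempty (Fin n × Fin n) := ⟨(⟨0, hn⟩, ⟨0, hn⟩)⟩
  obtain ⟨ij, hij⟩ := Finite.exists_min fun ij : Fin n × Fin n => Real.log (A₀ ij.1 ij.2)
  refine ⟨Real.log (A₀ ij.1 ij.2), fun x j => ?_⟩
  calc Real.log (A₀ ij.1 ij.2) + x j
      = ∑ i, wopt i * (Real.log (A₀ ij.1 ij.2) + x j) := by
        rw [← Finset.sum_mul, hopt.2, one_mul]
    _ ≤ _ := Finset.sum_le_sum fun i _ => mul_le_mul_of_nonneg_left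
        ((add_le_add_left (hij (i, j)) _).trans (log_add_le_log_sum_exp hA (hpos i j) x))
        (hopt.1 i).le

end Bounds

/-- For two individuals `wopt - w` is a multiple of `(1, -1)`, and so the energy derivative is a
nonpositive multiple of `U'`; energy decrease therefore pays for potential growth. -/
theorem IsCumulativeTrajectory.tendsto_of_two {p : Fin 2 → ℝ → ℝ}
    {A₀ : Matrix (Fin 2) (Fin 2) ℝ} {w₀ : Fin 2 → ℝ} {y w : ℝ → Fin 2 → ℝ} {pstar : ℝ}
    {wopt : Fin 2 → ℝ} (hp : IsPerformanceFamily p)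
    (hA : A₀ ∈ Matrix.rowStochastic ℝ (Fin 2)) (hirr : A₀.IsIrreducible)
    (hpos : ∀ i j, 0 < A₀ i j)
    (hq : IsOptimalPair p (pstar, wopt)) (h : IsCumulativeTrajectory p A₀ w₀ y w) :
    ∃ Astar, Tendsto (fun t => (softAppraisal A₀ (y t), w t)) atTop (𝓝 (Astar, wopt)) ∧
      Astar ∈ Matrix.rowStochastic ℝ (Fin 2) ∧ SamePattern Astar A₀ ∧
      IsLeftDominantEigenvector Astar wopt := by
  obtain ⟨z, hz0, hz⟩ := h.exists_antiderivative_workload hp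
  obtain ⟨Θ, hΘ0, hΘ⟩ := h.exists_antiderivative hp hA
  obtain ⟨B, hB⟩ := h.exists_abs_sub_le hp hz0 hz hΘ0 hΘ
  have hopt := hq.2.1
  obtain ⟨c, hc⟩ := exists_le_log_sum_exp_sub one_le_two hA hpos hopt
  set U : ℝ → ℝ := fun t => ∑ i, wopt i * y t i - z t with hU
  set U' : ℝ → ℝ := fun t => ∑ i, (wopt i - w t i) * (p i (w t i) - p i (wopt i)) with hU'
  have hUd : ∀ t, 0 ≤ t → HasDerivWithinAt U (U' t) (Set.Ici 0) t := fun t ht =>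
    h.hasDerivWithinAt_potential hq hz ht
  have hU'0 : ∀ t, 0 ≤ t → 0 ≤ U' t := fun t ht => Finset.sum_nonneg fun i _ =>
    (hp.each i).gap_nonneg (intSimplex_mem_Ioc hopt i) (intSimplex_mem_Ioc (h.mem_w t ht) i)
  set E : ℝ → ℝ := fun t => ∑ i, wopt i * Real.log (∑ k, A₀ i k * Real.exp (y t k))
        - ∑ i, wopt i * y t i - (Θ t - z t) with hE
  set S : ℝ → Matrix (Fin 2) (Fin 2) ℝ := fun t => softAppraisal A₀ (y t) with hS
  have hSr : ∀ t, S t ∈ Matrix.rowStochastic ℝ (Fin 2) := fun t =>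
    softAppraisal_mem_rowStochastic hA _
  have hEd : ∀ t, 0 ≤ t → HasDerivWithinAt E (-((S t 0 1 + S t 1 0) * U' t)) (Set.Ici 0) t :=
    fun t ht => by
      refine (h.hasDerivWithinAt_energy hA hz hΘ ht).congr_deriv ?_
      have r0 : S t 0 0 + S t 0 1 = 1 := by
        simpa [Fin.sum_univ_two] using Matrix.sum_row_of_mem_rowStochastic (hSr t) 0
      have r1 : S t 1 0 + S t 1 1 = 1 := by
        simpa [Fin.sum_univ_two] using Matrix.sum_row_of_mem_rowStochastic (hSr t) 1
      have hw : w t 0 + w t 1 = 1 := by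
        simpa [Fin.sum_univ_two] using (h.mem_w t ht).2
      have hwo : wopt 0 + wopt 1 = 1 := by simpa [Fin.sum_univ_two] using hopt.2
      have hp01 : ∀ i, p i (wopt i) = pstar := fun i => congrFun hq.2.2 i
      simp only [hU', hp01, Fin.sum_univ_two]
      change (wopt 0 - w t 0) * (S t 0 0 * p 0 (w t 0) + S t 0 1 * p 1 (w t 1) - p 0 (w t 0))
        + (wopt 1 - w t 1) * (S t 1 0 * p 0 (w t 0) + S t 1 1 * p 1 (w t 1) - p 1 (w t 1)) = _
      rw [show S t 0 0 = 1 - S t 0 1 by linarith, show S t 1 1 = 1 - S t 1 0 by linarith,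
        show w t 1 = 1 - w t 0 by linarith, show wopt 1 = 1 - wopt 0 by linarith]
      ring
  have hSnn : ∀ t i j, 0 ≤ S t i j := fun t i j => (hSr t).1 i j
  have hE0 : E 0 = 0 := by
    simp [hE, h.init_y, hΘ0, hz0, Matrix.sum_row_of_mem_rowStochastic hA, -Fin.sum_univ_two]
  have hEle : ∀ t, 0 ≤ t → E t ≤ 0 := fun t ht => by
    have := antitoneOn_Ici_of_hasDerivWithinAt hEd (fun s hs => neg_nonpos.2
      (mul_nonneg (add_nonneg (hSnn s 0 1) (hSnn s 1 0)) (hU'0 s hs))) Set.self_mem_Ici ht ht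
    rwa [hE0] at this
  have hdev : ∀ t, 0 ≤ t → ∀ j, y t j - ∑ i, wopt i * y t i ≤ B - c := fun t ht j => by
    have h1 := hEle t ht
    have h2 := hc (y t) j
    simp only [hE] at h1
    linarith [(abs_le.1 (hB t ht)).2]
  have hElow : ∀ t, 0 ≤ t → c - B ≤ E t := fun t ht => by
    have h1 : ∑ i, wopt i * (c + y t i) ≤ ∑ i, wopt i *
        ∑ i, wopt i * Real.log (∑ k, A₀ i k * Real.exp (y t k)) :=
      Finset.sum_le_sum fun j _ => mul_le_mul_of_nonneg_left (hc (y t) j) (hopt.1 j).le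
    simp only [mul_add, Finset.sum_add_distrib] at h1
    rw [← Finset.sum_mul, ← Finset.sum_mul, hopt.2, one_mul, one_mul] at h1
    simp only [hE]
    linarith [(abs_le.1 (hB t ht)).2]
  -- For `j = 0`, the bound `hdev` reads `wopt 1 * (y 0 - y 1) ≤ B - c`. As `y 0` cannot outrun `y
  -- 1`, the second entry of row `0` stays away from zero.
  obtain ⟨κ, hκ, hκS⟩ : ∃ κ > 0, ∀ t, 0 ≤ t → κ ≤ S t 0 1 := by
    refine ⟨A₀ 0 1 / Real.exp |(B - c) / wopt 1|, div_pos (hpos 0 1) (Real.exp_pos _),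
      fun t ht => ?_⟩
    set M := |(B - c) / wopt 1| with hM
    have hy01 : y t 0 ≤ y t 1 + M := by
      have h1 := hdev t ht 0
      have hwo : wopt 0 + wopt 1 = 1 := by simpa [Fin.sum_univ_two] using hopt.2
      rw [Fin.sum_univ_two, show wopt 0 = 1 - wopt 1 by linarith] at h1
      have h2 : y t 0 - y t 1 ≤ (B - c) / wopt 1 := by
        rw [le_div_iff₀ (hopt.1 1)]
        linarith
      linarith [le_abs_self ((B - c) / wopt 1)]
    have hM0 : 0 ≤ M := abs_nonneg _
    have hD : ∑ k, A₀ 0 k * Real.exp (y t k) ≤ Real.exp (y t 1) * Real.exp M := by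
      have hr : A₀ 0 0 + A₀ 0 1 = 1 := by
        simpa [Fin.sum_univ_two] using Matrix.sum_row_of_mem_rowStochastic hA 0
      rw [Fin.sum_univ_two, ← Real.exp_add]
      have e1 := Real.exp_le_exp.2 hy01
      have e2 : Real.exp (y t 1) ≤ Real.exp (y t 1 + M) := Real.exp_le_exp.2 (by linarith)
      have e3 := mul_le_mul_of_nonneg_left e1 (hpos 0 0).le
      have e4 := mul_le_mul_of_nonneg_left e2 (hpos 0 1).le
      have e5 : A₀ 0 0 * Real.exp (y t 1 + M) + A₀ 0 1 * Real.exp (y t 1 + M)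
          = Real.exp (y t 1 + M) := by rw [← add_mul, hr, one_mul]
      linarith
    simp only [hS, softAppraisal]
    rw [div_le_div_iff₀ (Real.exp_pos _) (sum_mul_exp_pos hA _ _), mul_assoc]
    exact mul_le_mul_of_nonneg_left hD (hpos 0 1).le
  -- `κ * U + E` is nonincreasing from zero and `E ≥ c - B`.
  have hUle : ∀ t, 0 ≤ t → U t ≤ (B - c) / κ := fun t ht => by
    have := antitoneOn_Ici_of_hasDerivWithinAt
      (fun s hs => ((hUd s hs).const_mul κ).fun_add (hEd s hs)) (fun s hs => by
        nlinarith [mul_nonneg (sub_nonneg.2 (hκS s hs)) (hU'0 s hs),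
          mul_nonneg (hSnn s 1 0) (hU'0 s hs)]) Set.self_mem_Ici ht ht
    have hU0 : U 0 = 0 := by simp [hU, h.init_y, hz0]
    simp only [hU0, hE0] at this
    rw [le_div_iff₀ hκ]
    linarith [hElow t ht]
  refine h.tendsto_of_bounded one_le_two hp hA hirr (fun i => hpos i i) hq hz0 hz
    (C := (B - c) + (B - c) / κ) fun t ht j => ?_
  have h1 := hdev t ht j
  have h2 := hUle t ht
  simp only [hU] at h2
  linarith

/-! ### Existence, optimality and the three limit statements -/

theorem mainTheorem1 (n : ℕ) (hn : 1 ≤ n) (p : Fin n → ℝ → ℝ) (hp : IsPerformanceFamily p) :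
    ∃ (pstar : ℝ) (wopt : Fin n → ℝ),
      IsOptimalPair p (pstar, wopt) ∧
      (∀ q, IsOptimalPair p q → q = (pstar, wopt)) ∧
      ∀ (A₀ : Matrix (Fin n) (Fin n) ℝ) (w₀ : Fin n → ℝ),
        A₀ ∈ Matrix.rowStochastic ℝ (Fin n) → A₀.IsIrreducible → (∀ i, 0 < A₀ i i) →
        w₀ ∈ intSimplex n →
        (∃ A w, IsASAPTrajectory p A₀ w₀ A w) ∧
        (∃ v u, IsReducedTrajectory p A₀ w₀ v u) ∧
        ∀ A w, IsASAPTrajectory p A₀ w₀ A w →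
          -- two individuals, positive initial appraisals
          (n = 2 → (∀ i j, 0 < A₀ i j) →
            ∃ Astar : Matrix (Fin n) (Fin n) ℝ,
              Tendsto (fun t => (A t, w t)) atTop (𝓝 (Astar, wopt)) ∧
              (∀ i j, 0 < Astar i j) ∧
              Astar ∈ Matrix.rowStochastic ℝ (Fin n) ∧
              IsLeftDominantEigenvector Astar wopt) ∧
          -- rank-one initial appraisals
          ((∃ a ∈ intSimplex n, A₀ = Matrix.vecMulVec (fun _ => 1) a) →
            Tendsto (fun t => (A t, w t)) atTop
              (𝓝 (Matrix.vecMulVec (fun _ => 1) wopt, wopt))) ∧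
          -- bounded reduced-order variable
          (∀ v u, IsReducedTrajectory p A₀ w₀ v u →
            (∃ C : ℝ, ∀ t, 0 ≤ t → ∀ i, v t i ≤ C) →
            ∃ Astar : Matrix (Fin n) (Fin n) ℝ,
              Tendsto (fun t => (A t, w t)) atTop (𝓝 (Astar, wopt)) ∧
              Astar ∈ Matrix.rowStochastic ℝ (Fin n) ∧
              SamePattern Astar A₀ ∧
              IsLeftDominantEigenvector Astar wopt) := by
  obtain ⟨⟨pstar, wopt⟩, hq⟩ := exists_isOptimalPair hn hp
  refine ⟨pstar, wopt, hq, fun q hq' => hq'.unique hn hp hq, ?_⟩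
  intro A₀ w₀ hA hirr hdiag hw₀
  obtain ⟨y₁, w₁, h₁⟩ := exists_isCumulativeTrajectory hn hp hA hw₀
  obtain ⟨Θ₁, hΘ₁0, hΘ₁⟩ := h₁.exists_antiderivative hp hA
  refine ⟨⟨_, _, h₁.isASAPTrajectory hA⟩, ⟨_, _, h₁.isReducedTrajectory hΘ₁0 hΘ₁⟩, ?_⟩
  intro A w hAw
  obtain ⟨y, h, hAy⟩ := hAw.exists_cumulative hp hA hw₀
  have hev : (fun t => (softAppraisal A₀ (y t), w t)) =ᶠ[atTop] fun t => (A t, w t) := by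
    filter_upwards [eventually_ge_atTop 0] with t ht
    rw [hAy t ht]
  refine ⟨fun hn2 hpos => ?_, fun ⟨a, ha, hAa⟩ => ?_, fun v u hvu ⟨C, hC⟩ => ?_⟩
  · subst hn2
    obtain ⟨Astar, hlim, hst, hpat, hdom⟩ := h.tendsto_of_two hp hA hirr hpos hq
    exact ⟨Astar, hlim.congr' hev, fun i j => (hpat i j).2.2 (hpos i j), hst, hdom⟩
  · exact (h.tendsto_of_rank_one hn hp hA hirr hdiag hq ha hAa).congr' hev
  · obtain ⟨y', Θ, h', hΘ0, hΘ, hv⟩ := hvu.exists_cumulative hp hA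
    obtain ⟨Astar, hlim, hrest⟩ := h'.tendsto_of_reduced_bounded hn hp hA hirr hdiag hq hΘ0 hΘ
      (C := C) fun t ht i => by
        have h1 := hC t ht i
        rw [hv t ht i] at h1
        -- A bound on `v = exp(y' - Θ)` bounds its exponent, as `x ≤ exp x`.
        linarith [Real.add_one_le_exp (y' t i - Θ t)]
    refine ⟨Astar, (hlim.congr' ?_).congr' hev, hrest⟩
    filter_upwards [eventually_ge_atTop 0] with t ht
    -- The reduced solution and the appraisal trajectory come from the same cumulative trajectory,
    -- so the limit transfers.
    obtain ⟨e1, e2⟩ := h'.unique hn hp hA hw₀ h ht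
    rw [e1, e2]
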